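/- Let $0<p,q<1$ and let $\mu$ be the law on $\mathcal A^{\mathbb N}$, $\mathcal A=\{a,b\}$ with $a\neq b$, of a stationary Markov chain whose transition matrix $P$ satisfies $p_{aa}=p$ and $p_{bb}=q$ (so $p_{ab}=1-p$, $p_{ba}=1-q$). Let $f$ be the run-length encoder, which maps a sequence $$\underbrace{\alpha_1\cdots\alpha_1}_{k_1}\underbrace{\alpha_2\cdots\alpha_2}_{k_2}\cdots\qquad(\alpha_{i+1}\neq\alpha_i)$$ to the sequence $(\alpha_1,k_1)(\alpha_2,k_2)\cdots$ of symbols and lengths of its successive maximal runs ($f$ is thus defined $\mu$-almost everywhere). Let $f_*\mu$ be the push-forward of $\mu$ under $f$. Then the Rényi entropy of order $2$ of $f_*\mu$, $$H_2(f_*\mu)=-\lim_{n\to\infty}\frac1n\log\sum_{\omega}f_*\mu(\omega)^2,$$ where the sum is over all words $\omega$ of length $n$ over $\mathcal A\times\{1,2,\dots\}$ and $f_*\mu(\omega)$ is the measure of the set of sequences that begin with $\omega$, exists (that is, the limit exists) and $$H_2(f_*\mu)=-\frac12\log\left(\frac{(1-p)(1-q)}{(1+p)(1+q)}\right).$$ Moreover,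 for $\mu\otimes\mu$-almost every pair $(\mathbf x,\mathbf y)$, $$\lim_{n\to\infty}\frac{M^{RLE}_n(\mathbf x,\mathbf y)}{\log n}=\frac{4}{\log\left(\frac{(1+p)(1+q)}{(1-p)(1-q)}\right)},$$ where $M^{RLE}_n(\mathbf x,\mathbf y)$ is the largest $k$ such that the sequences $u=f(\mathbf x)$ and $v=f(\mathbf y)$ (indexed from $0$) satisfy $u_iu_{i+1}\cdots u_{i+k-1}=v_jv_{j+1}\cdots v_{j+k-1}$ for some $0\le i,j\le n-k$. -/

import Mathlib

open Filter Topology MeasureTheory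
open scoped ENNReal

namespace RunLength

noncomputable section

variable {A : Type*}

/-- The one-sided shift on sequences. -/
def shift (x : ℕ → A) : ℕ → A := fun n => x (n + 1)

/-- The cylinder of all sequences whose first `n` symbols form the word `w`. -/
def wordCylinder {n : ℕ} (w : Fin n → A) : Set (ℕ → A) := {x | ∀ i : Fin n, x i = w i}

/-- `μ` is the law on sequences of a stationary Markov chain with transition matrix `P`:
`P` is a stochastic matrix, `μ` is a shift invariant probability measure and
`μ (X₀ … Xₙ = w, Xₙ₊₁ = c) = μ (X₀ … Xₙ = w) * P (wₙ, c)` for every word `w` and every letter `c`.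
-/
structure IsStationaryMarkovChain [Fintype A] [DecidableEq A] [MeasurableSpace A]
    (P : Matrix A A ℝ) (μ : Measure (ℕ → A)) : Prop where
  stochastic : P ∈ Matrix.rowStochastic ℝ A
  isProbabilityMeasure : IsProbabilityMeasure μ
  stationary : MeasurePreserving shift μ μ
  markov : ∀ (n : ℕ) (w : Fin (n + 1) → A) (c : A),
    μ (wordCylinder w ∩ {x | x (n + 1) = c})
      = μ (wordCylinder w) * ENNReal.ofReal (P (w (Fin.last n)) c)

/-- The length of the run of equal symbols of `x` that starts at the position `s`: the least `k`
with `x (s + k) ≠ x s`. It is at least `1`, except that an infinite run gets the value `0`. -/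
def runLength (x : ℕ → A) (s : ℕ) : ℕ := sInf {k | x (s + k) ≠ x s}

/-- The position at which the run number `j` of `x` starts (runs are counted from `0`). -/
def runStart (x : ℕ → A) : ℕ → ℕ
  | 0 => 0
  | j + 1 => runStart x j + runLength x (runStart x j)

/-- The run-length encoder: the sequence of the pairs (symbol, length) of the successive maximal
runs of `x`. If `x` is eventually constant then its infinite last run is encoded by repeating
`(symbol, 0)` for ever. -/
def encode (x : ℕ → A) : ℕ → A × ℕ := fun j => (x (runStart x j), runLength x (runStart x j))

/-- The `n`-length of the longest common substring of `x` and `y`: the largest `k` such that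
`xᵢ … xᵢ₊ₖ₋₁ = yⱼ … yⱼ₊ₖ₋₁` for some `0 ≤ i, j ≤ n - k`. (The set contains `0` and is bounded by
`n`, so this supremum is a maximum.) -/
def lcsLength (n : ℕ) (x y : ℕ → A) : ℕ :=
  sSup {k | ∃ i j : ℕ, i + k ≤ n ∧ j + k ≤ n ∧ ∀ l < k, x (i + l) = y (j + l)}

/-- The `n`-length of the longest common substring of the run-length encodings of `x` and `y`. -/
def lcsLengthRLE (n : ℕ) (x y : ℕ → A) : ℕ := lcsLength n (encode x) (encode y)

/-- The measure `ν` on sequences has a Rényi entropy of order `k`, equal to `h`: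
the limit of `- 1 / ((k - 1) n) * log ∑ ν(w) ^ k`, the sum being over all words `w` of length `n`,
exists and equals `h`. The sum, its logarithm and the limit are taken in the extended reals. -/
def HasRenyiEntropy [MeasurableSpace A] (k : ℝ) (ν : Measure (ℕ → A)) (h : ℝ) : Prop :=
  Tendsto (fun n : ℕ =>
      -(((1 / ((k - 1) * n) : ℝ) : EReal)
        * ENNReal.log (∑' w : Fin n → A, ν (wordCylinder w) ^ k)))
    atTop (𝓝 (h : EReal))

section Measurability

variable [Countable A] [MeasurableSpace A] [MeasurableSingletonClass A]

theorem measurable_runLength (s : ℕ) : Measurable fun x : ℕ → A => runLength x s := by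
  have h : ∀ k : ℕ, MeasurableSet {x : ℕ → A | x (s + k) ≠ x s} := fun k =>
    (measurableSet_eq_fun (measurable_pi_apply (s + k)) (measurable_pi_apply s)).compl
  have key : ∀ m : ℕ, {x : ℕ → A | m ≤ runLength x s ∧ ∃ k, x (s + k) ≠ x s}
      = (⋂ k ∈ Set.Iio m, {x : ℕ → A | x (s + k) ≠ x s}ᶜ) ∩ ⋃ k, {x : ℕ → A | x (s + k) ≠ x s} := by
    intro m
    ext x
    simp only [Set.mem_ofPred_eq, Set.mem_inter_iff, Set.mem_iInter, Set.mem_iUnion,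
      Set.mem_compl_iff, Set.mem_Iio]
    refine and_congr_left fun hx => ⟨fun hm k hk hne => ?_, fun hm => ?_⟩
    · exact absurd (Nat.sInf_le (s := {k | x (s + k) ≠ x s}) hne) (by
        unfold runLength at hm; omega)
    · by_contra hlt
      exact hm _ (not_le.mp hlt) (Nat.sInf_mem (s := {k | x (s + k) ≠ x s}) hx)
  refine measurable_of_Ici fun m => ?_
  have : (fun x : ℕ → A => runLength x s) ⁻¹' Set.Ici m
      = {x : ℕ → A | m ≤ runLength x s ∧ ∃ k, x (s + k) ≠ x s}
        ∪ {x | m = 0 ∧ ¬ ∃ k, x (s + k) ≠ x s} := by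
    ext x
    simp only [Set.mem_preimage, Set.mem_Ici, Set.mem_union, Set.mem_ofPred_eq]
    by_cases hx : ∃ k, x (s + k) ≠ x s
    · simp [hx]
    · have : runLength x s = 0 := by
        exact Nat.sInf_eq_zero.mpr (Or.inr (Set.eq_empty_iff_forall_notMem.mpr
          fun k hk => hx ⟨k, hk⟩))
      simp [hx, this]
  rw [this, key]
  refine MeasurableSet.union (MeasurableSet.inter ?_ (MeasurableSet.iUnion h)) ?_
  · exact MeasurableSet.biInter (Set.to_countable _) fun k _ => (h k).compl
  · have hc : {x : ℕ → A | m = 0 ∧ ¬ ∃ k, x (s + k) ≠ x s}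
        = {_x : ℕ → A | m = 0} ∩ (⋃ k, {x : ℕ → A | x (s + k) ≠ x s})ᶜ := by
      ext x
      simp
    rw [hc]
    exact (MeasurableSet.const _).inter (MeasurableSet.iUnion h).compl

theorem measurable_runStart (j : ℕ) : Measurable fun x : ℕ → A => runStart x j := by
  induction j with
  | zero => exact measurable_const
  | succ j ih =>
    have h : Measurable fun p : ℕ × (ℕ → A) => runLength p.2 p.1 :=
      measurable_from_prod_countable_right fun s => measurable_runLength s
    exact ih.add (h.comp (ih.prodMk measurable_id))

/-- The encoder is measurable, so that the push-forward of a measure under it is meaningful. -/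
theorem measurable_encode : Measurable (encode : (ℕ → A) → ℕ → A × ℕ) := by
  refine measurable_pi_lambda _ fun j => ?_
  have h : Measurable fun p : ℕ × (ℕ → A) => (p.2 p.1, runLength p.2 p.1) :=
    measurable_from_prod_countable_right fun s =>
      (measurable_pi_apply s).prodMk (measurable_runLength s)
  exact h.comp ((measurable_runStart j).prodMk measurable_id)

end Measurability

end

end RunLength

namespace RunLength

open ProbabilityTheory

/-! Over a two-letter alphabet the symbols of successive runs alternate, so almost surely the
encoding is determined by the first symbol and the run lengths. By the Markov property, given the
first symbol, the lengths are independent, each with a geometric law depending only on the letter of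
its run (`measure_runEvent`, `map_runLengths`). Hence the measure of a word factors, and so does the
sum of squares: each run contributes its collision probability `κ s = (1 - P s s) / (1 + P s s)`.
Two consecutive runs contribute `κ a * κ b = σ ^ 2`, so the sum is `σ ^ n` up to bounded factors and
the entropy is `λ = -log σ`.

For the common substring, two blocks of `2 * r` runs that start with the same letter coincide with
probability `σ ^ (2 * r)`. A union bound over pairs of positions excludes such matches among `exp
((1 - ε) * λ * r)` runs (`prod_runMeasure_le_lcsLength_le`). Conversely, with about `exp ((1 + ε) *
λ * r)` disjoint, hence independent, blocks in each sequence, the second moment method produces a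
match (`prod_runMeasure_lcsLength_lt_le`). Both error probabilities are summable in `r`;
Borel-Cantelli and monotonicity in `n` give the limit `2 / λ`. -/

/-- The length of the run number `j` of `x`. -/
noncomputable def runLengths {A : Type*} (x : ℕ → A) (j : ℕ) : ℕ := runLength x (runStart x j)

/-! ### Run events as cylinders -/

section Runs

variable {A : Type*}

theorem runLength_eq_succ_iff (x : ℕ → A) (s m : ℕ) :
    runLength x s = m + 1 ↔ (∀ i ≤ m, x (s + i) = x s) ∧ x (s + m + 1) ≠ x s := by
  constructor
  · intro h
    refine ⟨fun i hi => ?_, ?_⟩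
    · by_contra hne
      have := Nat.sInf_le (s := {k | x (s + k) ≠ x s}) hne
      unfold runLength at h
      omega
    · have hne : {k | x (s + k) ≠ x s}.Nonempty := by
        by_contra hemp
        rw [Set.not_nonempty_iff_eq_empty] at hemp
        simp [runLength, hemp] at h
      have := Nat.sInf_mem hne
      unfold runLength at h
      rw [h] at this
      exact this
  · rintro ⟨h1, h2⟩
    refine le_antisymm (Nat.sInf_le (s := {k | x (s + k) ≠ x s}) h2) ?_
    refine le_csInf ⟨m + 1, h2⟩ fun k hk => ?_
    by_contra hlt
    exact hk (h1 k (by omega))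

/-- The offset `0` is never in the set defining the run length, so the value `0` can only come from
`sInf ∅ = 0`, an infinite run. -/
theorem eq_of_runLength_eq_zero {x : ℕ → A} {s : ℕ} (h : runLength x s = 0) (i : ℕ) :
    x (s + i) = x s := by
  rcases Nat.sInf_eq_zero.mp h with h | h
  · exact absurd rfl h
  · by_contra hne
    exact (Set.eq_empty_iff_forall_notMem.mp h) i hne

theorem runStart_eq_sum (x : ℕ → A) (n : ℕ) :
    runStart x n = ∑ j ∈ Finset.range n, runLengths x j := by
  induction n with
  | zero => rfl
  | succ n ih => rw [Finset.sum_range_succ, ← ih]; rfl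

/-- The event that the first symbol is `s` and the first `n` runs have lengths `k 0, …, k (n-1)`. -/
def runEvent (s : A) (k : ℕ → ℕ) (n : ℕ) : Set (ℕ → A) :=
  {x | x 0 = s ∧ ∀ j < n, runLengths x j = k j}

/-- `E` is a cylinder over the coordinates `0, …, K`, whose last letter is `c`. -/
def IsCylinderEnding (E : Set (ℕ → A)) (K : ℕ) (c : A) : Prop :=
  ∃ w : Fin (K + 1) → A, E = wordCylinder w ∧ w (Fin.last K) = c

theorem IsCylinderEnding.apply_eq {E : Set (ℕ → A)} {K : ℕ} {c : A} (h : IsCylinderEnding E K c)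
    {x : ℕ → A} (hx : x ∈ E) : x K = c := by
  obtain ⟨w, rfl, rfl⟩ := h
  exact hx (Fin.last K)

theorem IsCylinderEnding.snoc {E : Set (ℕ → A)} {K : ℕ} {c : A} (h : IsCylinderEnding E K c)
    (d : A) : IsCylinderEnding (E ∩ {x | x (K + 1) = d}) (K + 1) d := by
  obtain ⟨w, rfl, rfl⟩ := h
  refine ⟨Fin.snoc w d, ?_, by simp⟩
  ext x
  simp [wordCylinder, Fin.forall_fin_succ']

/-- On the event, run `n` starts at the sum of the earlier lengths with the letter `c`. Length `m +
1` means that `c` persists for `m` further steps and then changes, and `hf` leaves `f c` as the only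
other letter. -/
theorem runEvent_succ_of_pos {f : A → A} (hf : ∀ s t, t ≠ s ↔ t = f s) {s c : A} {k : ℕ → ℕ}
    {n m : ℕ} (hm : k n = m + 1)
    (h : IsCylinderEnding (runEvent s k n) (∑ j ∈ Finset.range n, k j) c) :
    runEvent s k (n + 1) = (runEvent s k n ∩
      {x | ∀ i ≤ m, x (∑ j ∈ Finset.range n, k j + i) = c}) ∩
      {x | x (∑ j ∈ Finset.range n, k j + m + 1) = f c} := by
  have h1 : runEvent s k (n + 1) = runEvent s k n ∩ {x | runLengths x n = k n} := by
    ext x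
    simp only [runEvent, Set.mem_ofPred_eq, Set.mem_inter_iff, Nat.lt_succ_iff_lt_or_eq,
      or_imp, forall_and, forall_eq]
    tauto
  rw [h1, Set.inter_assoc]
  ext x
  refine and_congr_right fun hx => ?_
  have hK : runStart x n = ∑ j ∈ Finset.range n, k j := by
    rw [runStart_eq_sum]
    exact Finset.sum_congr rfl fun j hj => hx.2 j (Finset.mem_range.mp hj)
  simp only [Set.mem_ofPred_eq, Set.mem_inter_iff, hm, runLengths, runLength_eq_succ_iff, hK,
    h.apply_eq hx, hf]

theorem runEvent_succ_subset_of_zero {s c : A} {k : ℕ → ℕ} {n : ℕ} (hm : k n = 0)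
    (h : IsCylinderEnding (runEvent s k n) (∑ j ∈ Finset.range n, k j) c) (m : ℕ) :
    runEvent s k (n + 1) ⊆ runEvent s k n ∩
      {x | ∀ i ≤ m, x (∑ j ∈ Finset.range n, k j + i) = c} := by
  intro x hx
  have hx' : x ∈ runEvent s k n := ⟨hx.1, fun j hj => hx.2 j (by omega)⟩
  refine ⟨hx', fun i _ => ?_⟩
  have hK : runStart x n = ∑ j ∈ Finset.range n, k j := by
    rw [runStart_eq_sum]
    exact Finset.sum_congr rfl fun j hj => hx'.2 j (Finset.mem_range.mp hj)
  have h0 : runLength x (runStart x n) = 0 := (hx.2 n (by omega)).trans hm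
  rw [← hK, eq_of_runLength_eq_zero h0, hK, h.apply_eq hx']

theorem isCylinderEnding_runEvent_zero (s : A) (k : ℕ → ℕ) :
    IsCylinderEnding (runEvent s k 0) 0 s := by
  refine ⟨fun _ => s, ?_, rfl⟩
  ext x
  simp [runEvent, wordCylinder]

/-- The sequence of pairs (symbol, length) with first symbol `s`, symbols evolving by `f`, and
lengths `l`. -/
def runPairs (f : A → A) (s : A) (l : ℕ → ℕ) (j : ℕ) : A × ℕ := (f^[j] s, l j)

theorem encode_eq_runPairs (hf : ∀ s t, t ≠ s ↔ t = f s) {x : ℕ → A}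
    (hx : ∀ j, runLengths x j ≠ 0) : encode x = runPairs f (x 0) (runLengths x) := by
  have h : ∀ j, x (runStart x j) = f^[j] (x 0) := by
    intro j
    induction j with
    | zero => rfl
    | succ j ih =>
      obtain ⟨m, hm⟩ := Nat.exists_eq_succ_of_ne_zero (hx j)
      have := ((runLength_eq_succ_iff x _ m).mp hm).2
      rw [hf, ih] at this
      rw [Function.iterate_succ_apply', ← this, runStart]
      congr 1
      change _ + runLengths x j = _
      rw [hm]
      rfl
  funext j
  exact Prod.ext (h j) rfl

end Runs

/-! ### Independence of the run lengths from the Markov property -/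

section Chain

variable {A : Type*} [Fintype A] [DecidableEq A] [MeasurableSpace A]
  {P : Matrix A A ℝ} {μ : Measure (ℕ → A)}

theorem IsStationaryMarkovChain.measure_snoc (hμ : IsStationaryMarkovChain P μ)
    {E : Set (ℕ → A)} {K : ℕ} {c : A} (h : IsCylinderEnding E K c) (d : A) :
    μ (E ∩ {x | x (K + 1) = d}) = μ E * ENNReal.ofReal (P c d) := by
  obtain ⟨w, rfl, rfl⟩ := h
  exact hμ.markov K w d

theorem IsStationaryMarkovChain.measure_constant (hμ : IsStationaryMarkovChain P μ)
    {E : Set (ℕ → A)} {K : ℕ} {c : A} (h : IsCylinderEnding E K c) (m : ℕ) :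
    IsCylinderEnding (E ∩ {x | ∀ i ≤ m, x (K + i) = c}) (K + m) c ∧
      μ (E ∩ {x | ∀ i ≤ m, x (K + i) = c}) = μ E * ENNReal.ofReal (P c c) ^ m := by
  induction m with
  | zero =>
    have : E ∩ {x | ∀ i ≤ 0, x (K + i) = c} = E := by
      refine Set.inter_eq_left.mpr fun x hx i hi => ?_
      obtain rfl : i = 0 := by omega
      exact h.apply_eq hx
    rw [this]
    exact ⟨h, by simp⟩
  | succ m ih =>
    have : E ∩ {x | ∀ i ≤ m + 1, x (K + i) = c}
        = (E ∩ {x | ∀ i ≤ m, x (K + i) = c}) ∩ {x | x (K + m + 1) = c} := by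
      ext x
      simp only [Set.mem_inter_iff, Set.mem_ofPred_eq, Nat.le_succ_iff, or_imp, forall_and,
        forall_eq, and_assoc, Nat.succ_eq_add_one, add_assoc]
    rw [this, hμ.measure_snoc ih.1, ih.2, pow_succ, mul_assoc]
    exact ⟨ih.1.snoc c, rfl⟩

variable {f : A → A} {γ : A → Measure ℕ}

/-- Finite lengths of the first `n` runs also fix the first letter of the next run; this makes the
event a single cylinder, to which the Markov property applies. -/
theorem isCylinderEnding_runEvent (hμ : IsStationaryMarkovChain P μ)
    (hf : ∀ s t, t ≠ s ↔ t = f s) (s : A) {k : ℕ → ℕ} {n : ℕ} (hk : ∀ j < n, k j ≠ 0) :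
    IsCylinderEnding (runEvent s k n) (∑ j ∈ Finset.range n, k j) (f^[n] s) := by
  induction n with
  | zero => exact isCylinderEnding_runEvent_zero s k
  | succ n ih =>
    have h := ih fun j hj => hk j (by omega)
    obtain ⟨m, hm⟩ := Nat.exists_eq_succ_of_ne_zero (hk n (by omega))
    rw [runEvent_succ_of_pos hf hm h, Finset.sum_range_succ, hm, Function.iterate_succ_apply']
    exact (hμ.measure_constant h m).1.snoc _

/-- The run lengths of a two-state Markov chain are independent given the first symbol. -/
theorem measure_runEvent (hμ : IsStationaryMarkovChain P μ) (hf : ∀ s t, t ≠ s ↔ t = f s)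
    (hP : ∀ s, P s s < 1) (hγ0 : ∀ s, γ s {0} = 0)
    (hγ : ∀ s m, γ s {m + 1} = ENNReal.ofReal (P s s) ^ m * ENNReal.ofReal (P s (f s)))
    (s : A) (k : ℕ → ℕ) (n : ℕ) :
    μ (runEvent s k n) = μ {x | x 0 = s} * ∏ j ∈ Finset.range n, γ (f^[j] s) {k j} := by
  have := hμ.isProbabilityMeasure
  induction n with
  | zero => simp [runEvent]
  | succ n ih =>
    rw [Finset.prod_range_succ, ← mul_assoc, ← ih]
    by_cases hk : ∀ j < n, k j ≠ 0
    · have h := isCylinderEnding_runEvent hμ hf s hk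
      rcases Nat.eq_zero_or_eq_succ_pred (k n) with hm | hm
      · rw [hm, hγ0, mul_zero]
        -- An infinite run lies in the events of `m` repetitions for every `m`, whose measures decay
        -- geometrically.
        have hle : ∀ m, μ (runEvent s k (n + 1))
            ≤ μ (runEvent s k n) * ENNReal.ofReal (P (f^[n] s) (f^[n] s)) ^ m := fun m =>
          (measure_mono (runEvent_succ_subset_of_zero hm h m)).trans
            (hμ.measure_constant h m).2.le
        have hlt : ENNReal.ofReal (P (f^[n] s) (f^[n] s)) < 1 := by
          simpa using hP (f^[n] s)
        have hlim := ENNReal.Tendsto.const_mul (a := μ (runEvent s k n))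
          (ENNReal.tendsto_pow_atTop_nhds_zero_of_lt_one hlt) (Or.inr (measure_ne_top _ _))
        rw [mul_zero] at hlim
        exact le_antisymm (ge_of_tendsto' hlim hle) zero_le
      · rw [runEvent_succ_of_pos hf hm h, hμ.measure_snoc (hμ.measure_constant h _).1,
          (hμ.measure_constant h _).2, hm, Nat.succ_eq_add_one, hγ, mul_assoc]
        rfl
    · push Not at hk
      obtain ⟨j, hj, hj0⟩ := hk
      have h0 : μ (runEvent s k n) = 0 := by
        rw [ih, Finset.prod_eq_zero (Finset.mem_range.mpr hj) (by rw [hj0, hγ0]), mul_zero]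
      rw [h0, zero_mul]
      have hsub : runEvent s k (n + 1) ⊆ runEvent s k n :=
        fun x hx => ⟨hx.1, fun i hi => hx.2 i (by omega)⟩
      exact measure_mono_null hsub h0

end Chain

/-! ### The law of the sequence of run lengths -/

section Law

theorem eq_infinitePi_of_wordCylinder {B : Type*} [Countable B] [MeasurableSpace B]
    [MeasurableSingletonClass B] (ρ : ℕ → Measure B) [∀ j, IsProbabilityMeasure (ρ j)]
    {ν : Measure (ℕ → B)}
    (h : ∀ (n : ℕ) (w : Fin n → B), ν (wordCylinder w) = ∏ j : Fin n, ρ j {w j}) :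
    ν = Measure.infinitePi ρ := by
  refine Measure.eq_infinitePi ρ fun s t ht => ?_
  classical
  obtain ⟨n, hn⟩ := s.exists_nat_subset_range
  have hmeas : Measurable fun (x : ℕ → B) (j : Fin n) => x j := by fun_prop
  have hpi : ν.map (fun (x : ℕ → B) (j : Fin n) => x j) = Measure.pi fun j : Fin n => ρ j := by
    refine Measure.ext_of_singleton fun w => ?_
    rw [Measure.map_apply hmeas (measurableSet_singleton w), Measure.pi_singleton, ← h]
    congr 1
    ext x
    simp [wordCylinder, funext_iff]
  -- A box over the finite set `s` is a box over an initial segment, with free coordinates outside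
  -- `s`.
  have hset : Set.pi s t = (fun (x : ℕ → B) (j : Fin n) => x j) ⁻¹'
      Set.pi Set.univ fun j : Fin n => if (j : ℕ) ∈ s then t j else Set.univ := by
    ext x
    simp only [Set.mem_pi, Finset.mem_coe, Set.mem_preimage, Set.mem_univ, true_imp_iff]
    refine ⟨fun hx j => ?_, fun hx j hj => ?_⟩
    · split_ifs with hj
      · exact hx j hj
      · trivial
    · have := hx ⟨j, Finset.mem_range.mp (hn hj)⟩
      simpa [hj] using this
  rw [hset, ← Measure.map_apply hmeas, hpi, Measure.pi_pi,
    Fin.prod_univ_eq_prod_range (fun j => ρ j (if j ∈ s then t j else Set.univ)) n,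
    ← Finset.prod_subset hn]
  · exact Finset.prod_congr rfl fun j hj => by simp [hj]
  · intro j _ hj
    simp [hj]
  · exact MeasurableSet.univ_pi fun j => Set.to_countable _ |>.measurableSet

variable {A : Type*} [Fintype A] [MeasurableSpace A] [MeasurableSingletonClass A]

theorem measurable_runLengths : Measurable (runLengths : (ℕ → A) → ℕ → ℕ) :=
  measurable_pi_lambda _ fun j =>
    measurable_snd.comp ((measurable_pi_apply j).comp (measurable_encode (A := A)))

variable [DecidableEq A] {P : Matrix A A ℝ} {μ : Measure (ℕ → A)} {f : A → A} {γ : A → Measure ℕ}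

/-- The restricted, unnormalised form of the conditional law stays valid for a first symbol of
probability zero. -/
theorem map_runLengths (hμ : IsStationaryMarkovChain P μ) (hf : ∀ s t, t ≠ s ↔ t = f s)
    (hP : ∀ s, P s s < 1) [∀ s, IsProbabilityMeasure (γ s)] (hγ0 : ∀ s, γ s {0} = 0)
    (hγ : ∀ s m, γ s {m + 1} = ENNReal.ofReal (P s s) ^ m * ENNReal.ofReal (P s (f s))) (s : A) :
    (μ.restrict {x | x 0 = s}).map runLengths
      = μ {x | x 0 = s} • Measure.infinitePi fun j => γ (f^[j] s) := by
  have := hμ.isProbabilityMeasure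
  by_cases h0 : μ {x | x 0 = s} = 0
  · rw [h0, zero_smul, Measure.restrict_eq_zero.mpr h0, Measure.map_zero]
  have htop : μ {x | x 0 = s} ≠ ∞ := measure_ne_top _ _
  rw [← eq_infinitePi_of_wordCylinder (fun j => γ (f^[j] s))
    (ν := (μ {x | x 0 = s})⁻¹ • (μ.restrict {x | x 0 = s}).map runLengths), smul_smul,
    ENNReal.mul_inv_cancel h0 htop, one_smul]
  intro n w
  have hw : MeasurableSet (wordCylinder w) := by
    have : wordCylinder w = ⋂ i : Fin n, {x : ℕ → ℕ | x i = w i} := by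
      ext x
      simp [wordCylinder]
    rw [this]
    exact MeasurableSet.iInter fun i =>
      measurableSet_eq_fun (measurable_pi_apply _) measurable_const
  have hE : runLengths ⁻¹' wordCylinder w ∩ {x : ℕ → A | x 0 = s}
      = runEvent s (fun j => if h : j < n then w ⟨j, h⟩ else 0) n := by
    ext x
    simp only [Set.mem_inter_iff, Set.mem_preimage, wordCylinder, runEvent, Set.mem_ofPred_eq,
      Fin.forall_iff]
    rw [and_comm]
    refine and_congr_right fun _ => forall₂_congr fun j hj => ?_
    simp [hj]
  rw [Measure.smul_apply, Measure.map_apply measurable_runLengths hw,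
    Measure.restrict_apply (measurable_runLengths hw), hE, measure_runEvent hμ hf hP hγ0 hγ,
    smul_eq_mul, ← mul_assoc, ENNReal.inv_mul_cancel h0 htop, one_mul,
    ← Fin.prod_univ_eq_prod_range]
  simp

theorem ae_encode_eq_runPairs (hμ : IsStationaryMarkovChain P μ) (hf : ∀ s t, t ≠ s ↔ t = f s)
    (hP : ∀ s, P s s < 1) [∀ s, IsProbabilityMeasure (γ s)] (hγ0 : ∀ s, γ s {0} = 0)
    (hγ : ∀ s m, γ s {m + 1} = ENNReal.ofReal (P s s) ^ m * ENNReal.ofReal (P s (f s))) :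
    ∀ᵐ x ∂μ, encode x = runPairs f (x 0) (runLengths x) := by
  have key : ∀ (s : A) (j : ℕ), μ {x | x 0 = s ∧ runLengths x j = 0} = 0 := by
    intro s j
    have hm : MeasurableSet {l : ℕ → ℕ | l j = 0} :=
      measurableSet_eq_fun (measurable_pi_apply _) measurable_const
    have h := congrArg (fun ν => ν {l : ℕ → ℕ | l j = 0}) (map_runLengths hμ hf hP hγ0 hγ s)
    simp only [Measure.smul_apply, Measure.map_apply measurable_runLengths hm,
      Measure.restrict_apply (measurable_runLengths hm)] at h
    have h2 : (Measure.infinitePi fun j => γ (f^[j] s)) {l : ℕ → ℕ | l j = 0} = 0 := by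
      have := (measurePreserving_eval_infinitePi (fun j => γ (f^[j] s)) j).measure_preimage
        (measurableSet_singleton 0).nullMeasurableSet
      rw [hγ0] at this
      exact this
    rw [h2, smul_zero] at h
    rw [← h]
    congr 1
    ext x
    simp [and_comm]
  have hae : ∀ᵐ x ∂μ, ∀ (s : A) (j : ℕ), ¬ (x 0 = s ∧ runLengths x j = 0) :=
    ae_all_iff.mpr fun s => ae_all_iff.mpr fun j => measure_eq_zero_iff_ae_notMem.mp (key s j)
  filter_upwards [hae] with x hx
  exact encode_eq_runPairs hf fun j hj => hx _ j ⟨rfl, hj⟩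

end Law

/-! ### Products over alternating letters and their growth rate -/

section Sums

theorem tsum_pi_prod {B : Type*} : ∀ {n : ℕ} (g : Fin n → B → ℝ≥0∞),
    ∑' w : Fin n → B, ∏ j, g j (w j) = ∏ j, ∑' b, g j b := by
  intro n
  induction n with
  | zero => intro g; simp
  | succ n ih =>
    intro g
    rw [← (Fin.consEquiv fun _ => B).tsum_eq, ENNReal.tsum_prod', Fin.prod_univ_succ,
      ← ih fun j => g j.succ, ← ENNReal.tsum_mul_right]
    refine tsum_congr fun b => ?_
    rw [← ENNReal.tsum_mul_left]
    refine tsum_congr fun w => ?_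
    rw [Fin.prod_univ_succ]
    rfl

variable {A : Type*} {f : A → A} {κ : A → ℝ} {σ : ℝ}

theorem prod_iterate_even (hff : ∀ s, κ s * κ (f s) = σ ^ 2) (s : A) (r : ℕ) :
    ∏ j ∈ Finset.range (2 * r), κ (f^[j] s) = σ ^ (2 * r) := by
  induction r with
  | zero => simp
  | succ r ih =>
    rw [mul_add, mul_one, Finset.prod_range_succ, Finset.prod_range_succ, ih,
      Function.iterate_succ_apply', mul_assoc, hff, ← pow_add]

/-- Consecutive factors pair up to `σ ^ 2`. For odd `n` one factor is left over, and it lies between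
`σ ^ 2` and `1`. -/
theorem prod_iterate_bounds (hff : ∀ s, κ s * κ (f s) = σ ^ 2) (h0 : ∀ s, 0 < κ s)
    (h1 : ∀ s, κ s ≤ 1) (hσ0 : 0 < σ) (hσ1 : σ ≤ 1) (s : A) (n : ℕ) :
    σ ^ (n + 1) ≤ ∏ j ∈ Finset.range n, κ (f^[j] s) ∧
      σ * ∏ j ∈ Finset.range n, κ (f^[j] s) ≤ σ ^ n := by
  rcases Nat.even_or_odd' n with ⟨r, rfl | rfl⟩
  · rw [prod_iterate_even hff]
    refine ⟨pow_le_pow_of_le_one hσ0.le hσ1 (by omega), ?_⟩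
    exact mul_le_of_le_one_left (by positivity) hσ1
  · rw [Finset.prod_range_succ, prod_iterate_even hff]
    constructor
    · rw [show 2 * r + 1 + 1 = 2 * r + 2 by ring, pow_add, ← hff (f^[2 * r] s)]
      refine mul_le_mul_of_nonneg_left ?_ (by positivity)
      exact mul_le_of_le_one_right (h0 _).le (h1 _)
    · rw [pow_succ, mul_comm]
      refine mul_le_mul_of_nonneg_right ?_ hσ0.le
      exact mul_le_of_le_one_right (by positivity) (h1 _)

theorem tendsto_log_div_of_geometric_bounds {v : ℕ → ℝ} {c C σ : ℝ} (hc : 0 < c) (hσ : 0 < σ)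
    (h1 : ∀ n, c * σ ^ n ≤ v n) (h2 : ∀ n, v n ≤ C * σ ^ n) :
    Tendsto (fun n : ℕ => 1 / (n : ℝ) * Real.log (v n)) atTop (𝓝 (Real.log σ)) := by
  have hC : 0 < C := by
    have := (h1 0).trans (h2 0)
    simp only [pow_zero, mul_one] at this
    exact hc.trans_le this
  have lim : ∀ d : ℝ, Tendsto (fun n : ℕ => Real.log d / n + Real.log σ) atTop
      (𝓝 (Real.log σ)) := fun d => by
    simpa using (tendsto_const_div_atTop_nhds_zero_nat (Real.log d)).add_const (Real.log σ)
  have expand : ∀ d : ℝ, 0 < d → ∀ n : ℕ, 0 < n →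
      1 / (n : ℝ) * Real.log (d * σ ^ n) = Real.log d / n + Real.log σ := by
    intro d hd n hn
    rw [Real.log_mul hd.ne' (by positivity), Real.log_pow]
    field_simp
  refine tendsto_of_tendsto_of_tendsto_of_le_of_le' (lim c) (lim C) ?_ ?_
  · filter_upwards [eventually_gt_atTop 0] with n hn
    rw [← expand c hc n hn]
    exact mul_le_mul_of_nonneg_left (Real.log_le_log (by positivity) (h1 n)) (by positivity)
  · filter_upwards [eventually_gt_atTop 0] with n hn
    rw [← expand C hC n hn]
    have : 0 < v n := lt_of_lt_of_le (by positivity) (h1 n)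
    exact mul_le_mul_of_nonneg_left (Real.log_le_log this (h2 n)) (by positivity)

end Sums

/-! ### Rényi entropy of the encoded measure -/

section Renyi

variable {A : Type*} [Fintype A] [DecidableEq A] [MeasurableSpace A] [MeasurableSingletonClass A]
  {P : Matrix A A ℝ} {μ : Measure (ℕ → A)} {f : A → A} {γ : A → Measure ℕ}

theorem measurableSet_wordCylinder {B : Type*} [Countable B] [MeasurableSpace B]
    [MeasurableSingletonClass B] {n : ℕ} (w : Fin n → B) : MeasurableSet (wordCylinder w) := by
  have : wordCylinder w = ⋂ i : Fin n, {x : ℕ → B | x i = w i} := by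
    ext x
    simp [wordCylinder]
  rw [this]
  exact MeasurableSet.iInter fun i =>
    measurableSet_eq_fun (measurable_pi_apply _) measurable_const

theorem map_encode_wordCylinder_runPairs (hμ : IsStationaryMarkovChain P μ)
    (hf : ∀ s t, t ≠ s ↔ t = f s)
    (hP : ∀ s, P s s < 1) [∀ s, IsProbabilityMeasure (γ s)] (hγ0 : ∀ s, γ s {0} = 0)
    (hγ : ∀ s m, γ s {m + 1} = ENNReal.ofReal (P s s) ^ m * ENNReal.ofReal (P s (f s)))
    {n : ℕ} (hn : n ≠ 0) (s : A) (k : Fin n → ℕ) :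
    μ.map encode (wordCylinder fun j : Fin n => (f^[j] s, k j))
      = μ {x | x 0 = s} * ∏ j : Fin n, γ (f^[j] s) {k j} := by
  have hrun : ∏ j : Fin n, γ (f^[j] s) {k j} = ∏ j ∈ Finset.range n,
      γ (f^[j] s) {if h : j < n then k ⟨j, h⟩ else 0} := by
    rw [← Fin.prod_univ_eq_prod_range
      (fun j => γ (f^[j] s) {if h : j < n then k ⟨j, h⟩ else 0})]
    simp
  rw [Measure.map_apply measurable_encode (measurableSet_wordCylinder _), hrun,
    ← measure_runEvent hμ hf hP hγ0 hγ s (fun j => if h : j < n then k ⟨j, h⟩ else 0) n]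
  refine measure_congr ?_
  filter_upwards [ae_encode_eq_runPairs hμ hf hP hγ0 hγ] with x hx
  refine propext ?_
  change encode x ∈ wordCylinder _ ↔ x ∈ runEvent _ _ _
  rw [hx]
  simp only [wordCylinder, runEvent, Set.mem_ofPred_eq, runPairs, Prod.mk.injEq, forall_and]
  -- The first symbol is read off the first pair, so the word must be nonempty.
  refine and_congr ⟨fun h => h ⟨0, Nat.pos_of_ne_zero hn⟩, fun h => by simp [h]⟩ ?_
  rw [Fin.forall_iff]
  refine forall₂_congr fun j hj => ?_
  simp [hj]

theorem map_encode_wordCylinder_eq_zero (hμ : IsStationaryMarkovChain P μ)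
    (hf : ∀ s t, t ≠ s ↔ t = f s)
    (hP : ∀ s, P s s < 1) [∀ s, IsProbabilityMeasure (γ s)] (hγ0 : ∀ s, γ s {0} = 0)
    (hγ : ∀ s m, γ s {m + 1} = ENNReal.ofReal (P s s) ^ m * ENNReal.ofReal (P s (f s)))
    {n : ℕ} (w : Fin n → A × ℕ)
    (hw : ∀ (s : A) (k : Fin n → ℕ), (fun j : Fin n => (f^[j] s, k j)) ≠ w) :
    μ.map encode (wordCylinder w) = 0 := by
  rw [Measure.map_apply measurable_encode (measurableSet_wordCylinder _),
    measure_eq_zero_iff_ae_notMem]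
  filter_upwards [ae_encode_eq_runPairs hμ hf hP hγ0 hγ] with x hx hxw
  refine hw (x 0) (fun j => runLengths x j) (funext fun j => ?_)
  have := hxw j
  rw [hx] at this
  exact this

/-- Only words with alternating symbols carry mass. They are parametrised by first symbol and
lengths, and over the lengths the sum of products is a product of sums. -/
theorem tsum_map_encode_wordCylinder_sq (hμ : IsStationaryMarkovChain P μ)
    (hf : ∀ s t, t ≠ s ↔ t = f s)
    (hP : ∀ s, P s s < 1) [∀ s, IsProbabilityMeasure (γ s)] (hγ0 : ∀ s, γ s {0} = 0)
    (hγ : ∀ s m, γ s {m + 1} = ENNReal.ofReal (P s s) ^ m * ENNReal.ofReal (P s (f s)))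
    {n : ℕ} (hn : n ≠ 0) :
    ∑' w : Fin n → A × ℕ, μ.map encode (wordCylinder w) ^ 2
      = ∑ s, μ {x | x 0 = s} ^ 2 * ∏ j ∈ Finset.range n, ∑' k, γ (f^[j] s) {k} ^ 2 := by
  let φ : A × (Fin n → ℕ) → Fin n → A × ℕ := fun z j => (f^[j] z.1, z.2 j)
  have hφ : Function.Injective φ := by
    rintro ⟨s, k⟩ ⟨t, l⟩ h
    have h1 : ∀ j, f^[(j : Fin n)] s = f^[j] t ∧ k j = l j := fun j =>
      Prod.mk.inj (congrFun h j)
    exact Prod.ext (h1 ⟨0, Nat.pos_of_ne_zero hn⟩).1 (funext fun j => (h1 j).2)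
  rw [← hφ.tsum_eq, ENNReal.tsum_prod', tsum_fintype]
  · refine Finset.sum_congr rfl fun s _ => ?_
    have : ∀ k : Fin n → ℕ, μ.map encode (wordCylinder (φ (s, k))) ^ 2
        = μ {x | x 0 = s} ^ 2 * ∏ j : Fin n, γ (f^[j] s) {k j} ^ 2 := fun k => by
      rw [Finset.prod_pow, ← mul_pow, ← map_encode_wordCylinder_runPairs hμ hf hP hγ0 hγ hn]
    simp_rw [this]
    rw [ENNReal.tsum_mul_left, tsum_pi_prod fun (j : Fin n) k => γ (f^[j] s) {k} ^ 2,
      Fin.prod_univ_eq_prod_range fun j => ∑' k, γ (f^[j] s) {k} ^ 2]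
  · intro w hw
    by_contra hne
    refine hw ?_
    change _ ^ 2 = _
    rw [map_encode_wordCylinder_eq_zero hμ hf hP hγ0 hγ w fun s k h => hne ⟨(s, k), h⟩]
    simp

theorem hasRenyiEntropy_map_encode (hμ : IsStationaryMarkovChain P μ)
    (hf : ∀ s t, t ≠ s ↔ t = f s)
    (hP : ∀ s, P s s < 1) [∀ s, IsProbabilityMeasure (γ s)] (hγ0 : ∀ s, γ s {0} = 0)
    (hγ : ∀ s m, γ s {m + 1} = ENNReal.ofReal (P s s) ^ m * ENNReal.ofReal (P s (f s)))
    {κ : A → ℝ} {σ : ℝ} (hκ : ∀ s, ∑' k, γ s {k} ^ 2 = ENNReal.ofReal (κ s))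
    (hκσ : ∀ s, κ s * κ (f s) = σ ^ 2) (h0 : ∀ s, 0 < κ s)
    (h1 : ∀ s, κ s ≤ 1) (hσ0 : 0 < σ) (hσ1 : σ ≤ 1) :
    HasRenyiEntropy 2 (μ.map encode) (-Real.log σ) := by
  have := hμ.isProbabilityMeasure
  let v : ℕ → ℝ := fun n => ∑ s, μ.real {x | x 0 = s} ^ 2 * ∏ j ∈ Finset.range n, κ (f^[j] s)
  have hsum : ∀ n ≠ 0, ∑' w : Fin n → A × ℕ, μ.map encode (wordCylinder w) ^ (2 : ℝ)
      = ENNReal.ofReal (v n) := by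
    intro n hn
    simp_rw [ENNReal.rpow_two]
    rw [tsum_map_encode_wordCylinder_sq hμ hf hP hγ0 hγ hn, ENNReal.ofReal_sum_of_nonneg]
    · refine Finset.sum_congr rfl fun s _ => ?_
      rw [ENNReal.ofReal_mul (by positivity), ENNReal.ofReal_pow (by positivity),
        ofReal_measureReal, ENNReal.ofReal_prod_of_nonneg fun j _ => (h0 _).le]
      simp_rw [hκ]
    · intro s _
      exact mul_nonneg (by positivity) (Finset.prod_nonneg fun j _ => (h0 _).le)
  -- A first letter of positive probability makes the constant in the lower geometric bound
  -- positive.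
  obtain ⟨s₀, hs₀⟩ : ∃ s, 0 < μ.real {x | x 0 = s} := by
    by_contra! hcon
    have hz : ∀ᵐ x ∂μ, ∀ s : A, ¬ x 0 = s := by
      refine ae_all_iff.mpr fun s => measure_eq_zero_iff_ae_notMem.mp ?_
      exact (measureReal_eq_zero_iff).mp (le_antisymm (hcon s) measureReal_nonneg)
    obtain ⟨x, hx⟩ := hz.exists
    exact hx _ rfl
  have hlow : ∀ n, (μ.real {x | x 0 = s₀} ^ 2 * σ) * σ ^ n ≤ v n := by
    intro n
    refine le_trans ?_ (Finset.single_le_sum (f := fun s => μ.real {x | x 0 = s} ^ 2 *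
      ∏ j ∈ Finset.range n, κ (f^[j] s)) (fun s _ => mul_nonneg (by positivity)
      (Finset.prod_nonneg fun j _ => (h0 _).le)) (Finset.mem_univ s₀))
    rw [mul_assoc, ← pow_succ']
    exact mul_le_mul_of_nonneg_left (prod_iterate_bounds hκσ h0 h1 hσ0 hσ1 s₀ n).1 (by positivity)
  have hup : ∀ n, v n ≤ ((∑ s, μ.real {x | x 0 = s} ^ 2) / σ) * σ ^ n := by
    intro n
    rw [div_mul_eq_mul_div, Finset.sum_mul, le_div_iff₀ hσ0, Finset.sum_mul]
    refine Finset.sum_le_sum fun s _ => ?_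
    rw [mul_assoc, mul_comm _ σ]
    exact mul_le_mul_of_nonneg_left (prod_iterate_bounds hκσ h0 h1 hσ0 hσ1 s n).2 (by positivity)
  have hlim := tendsto_log_div_of_geometric_bounds (by positivity) hσ0 hlow hup
  refine Tendsto.congr' ?_ ((continuous_coe_real_ereal.tendsto _).comp hlim.neg)
  filter_upwards [eventually_ne_atTop 0] with n hn
  have hv : 0 < v n := lt_of_lt_of_le (by positivity) (hlow n)
  rw [hsum n hn, ENNReal.log_ofReal_of_pos hv, Function.comp_apply, EReal.coe_neg, EReal.coe_mul]
  norm_num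

end Renyi

/-! ### Second moment method for matching blocks -/

section SecondMoment

/-- The second moment method: if the number of the events `E i` that occur has mean `a` and
variance at most `b`, then none of them occurs with probability at most `b / a ^ 2`. -/
theorem measureReal_iInter_compl_le {Ω ι : Type*} [Fintype ι] [MeasurableSpace Ω] {μ : Measure Ω}
    [IsProbabilityMeasure μ] {E : ι → Set Ω} (hE : ∀ i, MeasurableSet (E i)) {a b : ℝ}
    (ha : 0 < a) (h1 : ∑ i, μ.real (E i) = a) (h2 : ∑ i, ∑ j, μ.real (E i ∩ E j) ≤ a ^ 2 + b) :
    μ.real {x | ∀ i, x ∉ E i} ≤ b / a ^ 2 := by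
  let N : Ω → ℝ := fun x => ∑ i, (E i).indicator 1 x
  have hL : MemLp N 2 μ := memLp_finsetSum _ fun i _ =>
    memLp_indicator_const 2 (hE i) (1 : ℝ) (Or.inr (measure_ne_top _ _))
  have hint : ∀ s : Set Ω, MeasurableSet s → Integrable (s.indicator (1 : Ω → ℝ)) μ := fun s hs =>
    (integrable_const (1 : ℝ)).indicator hs
  have hmean : ∫ x, N x ∂μ = a := by
    rw [integral_finsetSum _ fun i _ => hint _ (hE i), ← h1]
    exact Finset.sum_congr rfl fun i _ => integral_indicator_one (hE i)
  have hsq : ∫ x, (N ^ 2) x ∂μ = ∑ i, ∑ j, μ.real (E i ∩ E j) := by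
    have : N ^ 2 = fun x => ∑ i, ∑ j, (E i ∩ E j).indicator (1 : Ω → ℝ) x := by
      funext x
      simp only [N, Pi.pow_apply, sq, Finset.sum_mul_sum, Set.inter_indicator_one, Pi.mul_apply]
    rw [this, integral_finsetSum _ fun i _ => integrable_finsetSum _ fun j _ =>
      hint _ ((hE i).inter (hE j))]
    refine Finset.sum_congr rfl fun i _ => ?_
    rw [integral_finsetSum _ fun j _ => hint _ ((hE i).inter (hE j))]
    exact Finset.sum_congr rfl fun j _ => integral_indicator_one ((hE i).inter (hE j))
  have hvar : variance N μ ≤ b := by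
    rw [variance_eq_sub hL, hmean, hsq]
    linarith
  have hb : 0 ≤ b := (variance_nonneg N μ).trans hvar
  have hsub : {x | ∀ i, x ∉ E i} ⊆ {x | a ≤ |N x - ∫ y, N y ∂μ|} := by
    intro x hx
    have : N x = 0 := Finset.sum_eq_zero fun i _ => Set.indicator_of_notMem (hx i) _
    simp [this, hmean, abs_of_pos ha]
  refine ENNReal.toReal_le_of_le_ofReal (by positivity) ?_
  refine (measure_mono hsub).trans ((meas_ge_le_variance_div_sq hL ha).trans ?_)
  exact ENNReal.ofReal_le_ofReal (by gcongr)

theorem tsum_ite_eq_mul {W : Type*} [DecidableEq W] (g : W → ℝ≥0∞) :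
    ∑' p : W × W, (if p.1 = p.2 then 1 else 0) * g p.1 = ∑' w, g w := by
  rw [ENNReal.tsum_prod']
  refine tsum_congr fun w => ?_
  rw [tsum_eq_single w fun w' hw' => by simp [hw'.symm]]
  simp

/-- A single term of the sum of squares already gives `q w ≤ t`. -/
theorem tsum_cube_le {W : Type*} {q : W → ℝ≥0∞} {t : ℝ≥0∞} (h : ∑' w, q w ^ 2 = t ^ 2) :
    ∑' w, q w ^ 3 ≤ t ^ 3 := by
  have hq : ∀ w, q w ≤ t := fun w => by
    have := (ENNReal.le_tsum w).trans h.le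
    exact (ENNReal.pow_right_strictMono two_ne_zero).le_iff_le.mp this
  calc ∑' w, q w ^ 3 ≤ ∑' w, t * q w ^ 2 := ENNReal.tsum_le_tsum fun w => by
        rw [pow_succ']
        exact mul_le_mul_left (hq w) _
    _ = t ^ 3 := by rw [ENNReal.tsum_mul_left, h, pow_succ' t 2]

/-- Adding the diagonal and the independent contributions bounds both cases by one polynomial in the
indicators, which can then be multiplied out and summed. -/
theorem measure_pair_le {Ω W : Type*} [MeasurableSpace Ω] {μ : Measure Ω} [DecidableEq W] {m : ℕ} {X : Fin m → Ω → W} {q : W → ℝ≥0∞}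
    (h1 : ∀ i w, μ {x | X i x = w} = q w)
    (h2 : ∀ i j, i ≠ j → ∀ w w', μ {x | X i x = w ∧ X j x = w'} = q w * q w')
    (i j : Fin m) (w w' : W) : μ {x | X i x = w ∧ X j x = w'} ≤
      (if i = j then 1 else 0) * (if w = w' then 1 else 0) * q w + q w * q w' := by
  by_cases hij : i = j
  · subst hij
    by_cases hw : w = w'
    · subst hw
      simp [h1]
    · have : {x | X i x = w ∧ X i x = w'} = ∅ :=
        Set.eq_empty_iff_forall_notMem.mpr fun x hx => hw (hx.1.symm.trans hx.2)
      simp [this]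
  · simp [hij, h2 i j hij w w']

variable {Ω Ω' W : Type*} [MeasurableSpace Ω] [MeasurableSpace Ω'] [Countable W]
  [MeasurableSpace W] [MeasurableSingletonClass W] {μ : Measure Ω} {ν : Measure Ω'}

theorem prod_measure_eq_tsum [SFinite ν] {X : Ω → W} {Y : Ω' → W} (hX : Measurable X)
    (hY : Measurable Y) :
    (μ.prod ν) {z | X z.1 = Y z.2} = ∑' w, μ {x | X x = w} * ν {y | Y y = w} := by
  have : {z : Ω × Ω' | X z.1 = Y z.2} = ⋃ w, {x | X x = w} ×ˢ {y | Y y = w} := by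
    ext z
    simp [eq_comm]
  rw [this, measure_iUnion]
  · simp_rw [Measure.prod_prod]
  · intro w w' hne
    refine Set.disjoint_left.mpr fun z hz hz' => hne ?_
    exact hz.1.symm.trans hz'.1
  · exact fun w => (hX (measurableSet_singleton w)).prod (hY (measurableSet_singleton w))

theorem prod_measure_inter_le [DecidableEq W] [SFinite ν] {X X' : Ω → W} {Y Y' : Ω' → W}
    (hX : Measurable X) (hX' : Measurable X') (hY : Measurable Y) (hY' : Measurable Y')
    {q : W → ℝ≥0∞} {e e' : ℝ≥0∞}
    (h : ∀ w w', μ {x | X x = w ∧ X' x = w'} ≤ e * (if w = w' then 1 else 0) * q w + q w * q w')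
    (h' : ∀ w w', ν {y | Y y = w ∧ Y' y = w'} ≤
      e' * (if w = w' then 1 else 0) * q w + q w * q w') :
    (μ.prod ν) ({z | X z.1 = Y z.2} ∩ {z | X' z.1 = Y' z.2}) ≤
      e * e' * ∑' w, q w ^ 2 + (e + e') * ∑' w, q w ^ 3 + (∑' w, q w ^ 2) ^ 2 := by
  have hset : {z : Ω × Ω' | X z.1 = Y z.2} ∩ {z | X' z.1 = Y' z.2}
      = {z | (X z.1, X' z.1) = (Y z.2, Y' z.2)} := by
    ext z
    simp
  rw [hset, prod_measure_eq_tsum (hX.prodMk hX') (hY.prodMk hY')]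
  have hpt : ∀ p : W × W, μ {x | (X x, X' x) = p} * ν {y | (Y y, Y' y) = p} ≤
      e * e' * ((if p.1 = p.2 then 1 else 0) * q p.1 ^ 2)
        + (e + e') * ((if p.1 = p.2 then 1 else 0) * q p.1 ^ 3) + q p.1 ^ 2 * q p.2 ^ 2 := by
    rintro ⟨w, w'⟩
    simp only [Prod.mk.injEq]
    refine (mul_le_mul' (h w w') (h' w w')).trans (le_of_eq ?_)
    split_ifs with hw
    · subst hw
      ring
    · ring
  refine (ENNReal.tsum_le_tsum hpt).trans (le_of_eq ?_)
  rw [ENNReal.tsum_add, ENNReal.tsum_add, ENNReal.tsum_mul_left, ENNReal.tsum_mul_left,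
    tsum_ite_eq_mul fun w => q w ^ 2, tsum_ite_eq_mul fun w => q w ^ 3,
    ENNReal.tsum_prod' (f := fun p : W × W => q p.1 ^ 2 * q p.2 ^ 2)]
  simp_rw [ENNReal.tsum_mul_left, ENNReal.tsum_mul_right]
  rw [sq (∑' w, q w ^ 2)]

/-- Two independent families of `m` pairwise independent random variables with the same law, of
collision probability `t ^ 2`, are disjoint with probability at most `3 / (m * t)`. -/
theorem measureReal_forall_ne_le [IsProbabilityMeasure μ] [IsProbabilityMeasure ν] {m : ℕ}
    (hm : 0 < m) {X : Fin m → Ω → W} {Y : Fin m → Ω' → W} (hX : ∀ i, Measurable (X i))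
    (hY : ∀ i, Measurable (Y i)) {q : W → ℝ≥0∞} {t : ℝ} (ht : 0 < t)
    (hq : ∑' w, q w ^ 2 = ENNReal.ofReal t ^ 2)
    (hX1 : ∀ i w, μ {x | X i x = w} = q w) (hY1 : ∀ i w, ν {y | Y i y = w} = q w)
    (hX2 : ∀ i j, i ≠ j → ∀ w w', μ {x | X i x = w ∧ X j x = w'} = q w * q w')
    (hY2 : ∀ i j, i ≠ j → ∀ w w', ν {y | Y i y = w ∧ Y j y = w'} = q w * q w') :
    (μ.prod ν).real {z | ∀ i j, X i z.1 ≠ Y j z.2} ≤ 3 / (m * t) := by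
  classical
  have hm0 : (0 : ℝ) < m := Nat.cast_pos.mpr hm
  -- For `m * t < 1` the claimed bound exceeds `1`.
  rcases lt_or_ge (m * t) 1 with hlt | hge
  · refine measureReal_le_one.trans ?_
    rw [le_div_iff₀ (by positivity)]
    linarith
  let E : Fin m × Fin m → Set (Ω × Ω') := fun p => {z | X p.1 z.1 = Y p.2 z.2}
  have hE : ∀ p, MeasurableSet (E p) := fun p =>
    measurableSet_eq_fun ((hX p.1).comp measurable_fst) ((hY p.2).comp measurable_snd)
  have hE1 : ∀ p, (μ.prod ν).real (E p) = t ^ 2 := by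
    intro p
    have : (μ.prod ν) (E p) = ENNReal.ofReal t ^ 2 := by
      rw [prod_measure_eq_tsum (hX _) (hY _), ← hq]
      simp_rw [hX1, hY1, sq]
    rw [measureReal_def, this, ENNReal.toReal_pow, ENNReal.toReal_ofReal ht.le]
  have hE2 : ∀ p p', (μ.prod ν).real (E p ∩ E p') ≤
      (if p.1 = p'.1 then 1 else 0) * (if p.2 = p'.2 then 1 else 0) * t ^ 2 +
        ((if p.1 = p'.1 then 1 else 0) + (if p.2 = p'.2 then 1 else 0)) * t ^ 3 + t ^ 4 := by
    intro p p'
    have h := prod_measure_inter_le (hX p.1) (hX p'.1) (hY p.2) (hY p'.2)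
      (measure_pair_le hX1 hX2 p.1 p'.1) (measure_pair_le hY1 hY2 p.2 p'.2)
    refine ENNReal.toReal_le_of_le_ofReal (by positivity) (h.trans ?_)
    rw [hq, ← pow_mul]
    refine (add_le_add_left (add_le_add_right (mul_le_mul_right (tsum_cube_le hq) _) _) _).trans ?_
    rw [ENNReal.ofReal_add (by positivity) (by positivity),
      ENNReal.ofReal_add (by positivity) (by positivity),
      ENNReal.ofReal_mul (by positivity), ENNReal.ofReal_mul (by positivity),
      ENNReal.ofReal_mul (by positivity), ENNReal.ofReal_add (by positivity) (by positivity),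
      ENNReal.ofReal_pow ht.le, ENNReal.ofReal_pow ht.le, ENNReal.ofReal_pow ht.le]
    refine le_of_eq ?_
    congr 3 <;> split_ifs <;> simp
  -- The expected number of matches is `m ^ 2 * t ^ 2`. Among pairs of matches, equal ones
  -- contribute at most `(m * t) ^ 2`, those sharing a block on one given side at most `(m * t) ^
  -- 3`, and the product term sums to the squared mean.
  have hmain := measureReal_iInter_compl_le (μ := μ.prod ν) hE (a := (m * t) ^ 2)
    (b := (m * t) ^ 2 + 2 * (m * t) ^ 3) (by positivity)
    (by simp [hE1]; ring) (by
      let d : Fin m → Fin m → ℝ := fun i j => if i = j then 1 else 0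
      have hd : ∀ i, ∑ j, d i j = 1 := fun i => by simp [d]
      have e1 : ∀ p : Fin m × Fin m, ∑ p' : Fin m × Fin m, d p.1 p'.1 * d p.2 p'.2 = 1 :=
        fun p => by simp_rw [Fintype.sum_prod_type, ← Finset.mul_sum, hd, mul_one, hd]
      have e2 : ∀ p : Fin m × Fin m, ∑ p' : Fin m × Fin m, d p.1 p'.1 = m := fun p => by
        simp_rw [Fintype.sum_prod_type_right, hd]
        simp
      have e3 : ∀ p : Fin m × Fin m, ∑ p' : Fin m × Fin m, d p.2 p'.2 = m := fun p => by
        simp_rw [Fintype.sum_prod_type, hd]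
        simp
      have hE3 : ∀ p p', (μ.prod ν).real (E p ∩ E p') ≤ d p.1 p'.1 * d p.2 p'.2 * t ^ 2 +
        (d p.1 p'.1 + d p.2 p'.2) * t ^ 3 + t ^ 4 := hE2
      refine (Finset.sum_le_sum fun p _ => Finset.sum_le_sum fun p' _ => hE3 p p').trans
        (le_of_eq ?_)
      simp_rw [Finset.sum_add_distrib, ← Finset.sum_mul, Finset.sum_add_distrib, e1, e2, e3]
      simp only [Finset.sum_const, Finset.card_univ, Fintype.card_prod, Fintype.card_fin,
        nsmul_eq_mul, mul_one]
      push_cast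
      ring)
  have hset : {z : Ω × Ω' | ∀ i j, X i z.1 ≠ Y j z.2} = {z | ∀ p, z ∉ E p} := by
    ext z
    simp [E]
  rw [hset]
  refine hmain.trans ?_
  rw [div_le_div_iff₀ (by positivity) (by positivity)]
  have : (m * t) ^ 3 ≤ (m * t) ^ 4 := pow_le_pow_right₀ hge (by norm_num)
  nlinarith

end SecondMoment

/-! ### Elementary properties of the longest common substring -/

section CommonSubstring

variable {A : Type*}

theorem le_lcsLength_iff {n k : ℕ} {x y : ℕ → A} : k ≤ lcsLength n x y ↔
    ∃ i j : ℕ, i + k ≤ n ∧ j + k ≤ n ∧ ∀ l < k, x (i + l) = y (j + l) := by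
  have hb : BddAbove {k | ∃ i j : ℕ, i + k ≤ n ∧ j + k ≤ n ∧ ∀ l < k, x (i + l) = y (j + l)} :=
    ⟨n, by rintro k ⟨i, j, h, _⟩; omega⟩
  refine ⟨fun h => ?_, fun h => le_csSup hb h⟩
  obtain ⟨i, j, hi, hj, hl⟩ := Nat.sSup_mem (⟨0, 0, 0, by simp⟩ : Set.Nonempty {k | ∃ i j : ℕ,
    i + k ≤ n ∧ j + k ≤ n ∧ ∀ l < k, x (i + l) = y (j + l)}) hb
  change i + lcsLength n x y ≤ n at hi
  change j + lcsLength n x y ≤ n at hj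
  exact ⟨i, j, by omega, by omega, fun l hlk => hl l (lt_of_lt_of_le hlk h)⟩

theorem monotone_lcsLength (x y : ℕ → A) : Monotone fun n => lcsLength n x y := by
  intro n n' hn
  obtain ⟨i, j, hi, hj, hl⟩ := le_lcsLength_iff.mp (le_refl (lcsLength n x y))
  exact le_lcsLength_iff.mpr ⟨i, j, hi.trans hn, hj.trans hn, hl⟩

end CommonSubstring

/-! ### From exponential scales to all lengths -/

section Interpolation

variable {M : ℕ → ℕ} {lam ε : ℝ}

theorem eventually_two_mul_mul_ceil_exp_le (hlam : 0 < lam) (hε : 0 < ε) :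
    ∀ᶠ r : ℕ in atTop, (2 * r * ⌈Real.exp ((1 + ε) * lam * r)⌉₊ + 1 : ℝ)
      ≤ Real.exp ((1 + 2 * ε) * lam * r) := by
  have hc : 0 < ε * lam := by positivity
  -- With `x = ε * lam * r`, this threshold gives `x ^ 2 / 2 ≥ 4 * r`, so the quadratic lower bound
  -- for `exp x` absorbs the factor `4 * r + 1`.
  filter_upwards [eventually_ge_atTop ⌈8 / (ε * lam) ^ 2⌉₊] with r hr
  have hr' : 8 ≤ r * (ε * lam) ^ 2 := (div_le_iff₀ (by positivity)).mp (Nat.ceil_le.mp hr)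
  have h1 : (4 * r + 1 : ℝ) ≤ Real.exp (ε * lam * r) := by
    have := Real.quadratic_le_exp_of_nonneg (x := ε * lam * r) (by positivity)
    have h2 : (r : ℝ) * 8 ≤ r * (r * (ε * lam) ^ 2) := by gcongr
    have h3 : 0 ≤ ε * lam * r := by positivity
    nlinarith
  have h2 : (1 : ℝ) ≤ Real.exp ((1 + ε) * lam * r) := Real.one_le_exp (by positivity)
  have h3 := (Nat.ceil_lt_add_one (Real.exp_pos ((1 + ε) * lam * r)).le).le
  calc (2 * r * ⌈Real.exp ((1 + ε) * lam * r)⌉₊ + 1 : ℝ)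
      ≤ 2 * r * (Real.exp ((1 + ε) * lam * r) + Real.exp ((1 + ε) * lam * r))
        + Real.exp ((1 + ε) * lam * r) := by gcongr; linarith
    _ = (4 * r + 1) * Real.exp ((1 + ε) * lam * r) := by ring
    _ ≤ Real.exp (ε * lam * r) * Real.exp ((1 + ε) * lam * r) := by gcongr
    _ = Real.exp ((1 + 2 * ε) * lam * r) := by rw [← Real.exp_add]; ring_nf

/-- The integer `r = ⌊log N / ((1 + 2 * ε) * lam)⌋₊` gives a scale that fits below `N`; rounding
costs at most `2` in `M N`. -/
theorem eventually_le_div_log (hM : Monotone M) (hlam : 0 < lam) (hε : 0 < ε)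
    (h : ∀ᶠ r : ℕ in atTop, 2 * r ≤ M (2 * r * ⌈Real.exp ((1 + ε) * lam * r)⌉₊ + 1)) :
    ∀ᶠ N : ℕ in atTop, 2 / ((1 + 2 * ε) * lam) - 2 / Real.log N ≤ M N / Real.log N := by
  have hc : 0 < (1 + 2 * ε) * lam := by positivity
  have hlog : Tendsto (fun N : ℕ => Real.log N) atTop atTop :=
    Real.tendsto_log_atTop.comp tendsto_natCast_atTop_atTop
  have hr : Tendsto (fun N : ℕ => ⌊Real.log N / ((1 + 2 * ε) * lam)⌋₊) atTop atTop :=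
    tendsto_nat_floor_atTop.comp (hlog.atTop_div_const hc)
  filter_upwards [hr.eventually h, hr.eventually (eventually_two_mul_mul_ceil_exp_le hlam hε),
    hlog.eventually_gt_atTop 0, eventually_gt_atTop 0] with N h1 h2 h3 h4
  set r := ⌊Real.log N / ((1 + 2 * ε) * lam)⌋₊
  have hN : (0 : ℝ) < N := Nat.cast_pos.mpr h4
  have hle : 2 * r * ⌈Real.exp ((1 + ε) * lam * r)⌉₊ + 1 ≤ N := by
    have h5 : Real.exp ((1 + 2 * ε) * lam * r) ≤ N := by
      rw [← Real.le_log_iff_exp_le hN, mul_comm, ← le_div_iff₀ hc]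
      exact Nat.floor_le (by positivity)
    exact_mod_cast h2.trans h5
  have h6 : ((2 * r : ℕ) : ℝ) ≤ M N := Nat.cast_le.mpr (h1.trans (hM hle))
  have h7 := Nat.lt_floor_add_one (Real.log N / ((1 + 2 * ε) * lam))
  change _ < (r : ℝ) + 1 at h7
  push_cast at h6
  rw [le_div_iff₀ h3, sub_mul, div_mul_cancel₀ _ h3.ne', div_mul_eq_mul_div, mul_div_assoc]
  linarith

theorem eventually_div_log_le (hM : Monotone M) (hlam : 0 < lam) (hε1 : ε < 1)
    (h : ∀ᶠ r : ℕ in atTop, M ⌊Real.exp ((1 - ε) * lam * r)⌋₊ < 2 * r) :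
    ∀ᶠ N : ℕ in atTop, M N / Real.log N ≤ 2 / ((1 - ε) * lam) + 2 / Real.log N := by
  have hc : 0 < (1 - ε) * lam := mul_pos (by linarith) hlam
  have hlog : Tendsto (fun N : ℕ => Real.log N) atTop atTop :=
    Real.tendsto_log_atTop.comp tendsto_natCast_atTop_atTop
  have hr : Tendsto (fun N : ℕ => ⌈Real.log N / ((1 - ε) * lam)⌉₊) atTop atTop :=
    tendsto_nat_ceil_atTop.comp (hlog.atTop_div_const hc)
  filter_upwards [hr.eventually h, hlog.eventually_gt_atTop 0, eventually_gt_atTop 0]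
    with N h1 h3 h4
  set r := ⌈Real.log N / ((1 - ε) * lam)⌉₊
  have hN : (0 : ℝ) < N := Nat.cast_pos.mpr h4
  have hle : N ≤ ⌊Real.exp ((1 - ε) * lam * r)⌋₊ := by
    refine Nat.le_floor ?_
    rw [← Real.log_le_iff_le_exp hN, mul_comm, ← div_le_iff₀ hc]
    exact Nat.le_ceil _
  have h6 : (M N : ℝ) ≤ (2 * r : ℕ) := Nat.cast_le.mpr ((hM hle).trans h1.le)
  have h7 := Nat.ceil_lt_add_one (a := Real.log N / ((1 - ε) * lam)) (by positivity)
  change (r : ℝ) < _ at h7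
  push_cast at h6
  rw [div_le_iff₀ h3, add_mul, div_mul_cancel₀ _ h3.ne', div_mul_eq_mul_div, mul_div_assoc]
  linarith

/-- Countably many `ε k` suffice, so the almost sure statements feeding the hypotheses can be
intersected. -/
theorem tendsto_div_log_of_exp_bounds (hM : Monotone M) (hlam : 0 < lam) {ε : ℕ → ℝ}
    (hε0 : ∀ k, 0 < ε k) (hε1 : ∀ k, ε k < 1) (hε : Tendsto ε atTop (𝓝 0))
    (hlow : ∀ k, ∀ᶠ r : ℕ in atTop,
      2 * r ≤ M (2 * r * ⌈Real.exp ((1 + ε k) * lam * r)⌉₊ + 1))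
    (hup : ∀ k, ∀ᶠ r : ℕ in atTop, M ⌊Real.exp ((1 - ε k) * lam * r)⌋₊ < 2 * r) :
    Tendsto (fun N : ℕ => (M N : ℝ) / Real.log N) atTop (𝓝 (2 / lam)) := by
  have hlog : Tendsto (fun N : ℕ => 2 / Real.log N) atTop (𝓝 0) :=
    Tendsto.const_div_atTop (Real.tendsto_log_atTop.comp tendsto_natCast_atTop_atTop) 2
  refine tendsto_order.mpr ⟨fun a ha => ?_, fun a ha => ?_⟩
  · have hlim : Tendsto (fun k => 2 / ((1 + 2 * ε k) * lam)) atTop (𝓝 (2 / lam)) := by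
      have : Tendsto (fun k => (1 + 2 * ε k) * lam) atTop (𝓝 ((1 + 2 * 0) * lam)) :=
        ((hε.const_mul 2).const_add 1).mul_const lam
      simpa [div_eq_mul_inv, -mul_inv_rev] using (this.inv₀ (by simpa using hlam.ne')).const_mul 2
    obtain ⟨k, hk⟩ := (hlim.eventually_const_lt ha).exists
    have h2 : Tendsto (fun N : ℕ => 2 / ((1 + 2 * ε k) * lam) - 2 / Real.log N) atTop
        (𝓝 (2 / ((1 + 2 * ε k) * lam))) := by simpa using hlog.const_sub _
    filter_upwards [h2.eventually_const_lt hk, eventually_le_div_log hM hlam (hε0 k) (hlow k)]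
      with N h3 h4 using h3.trans_le h4
  · have hlim : Tendsto (fun k => 2 / ((1 - ε k) * lam)) atTop (𝓝 (2 / lam)) := by
      have : Tendsto (fun k => (1 - ε k) * lam) atTop (𝓝 ((1 - 0) * lam)) :=
        (hε.const_sub 1).mul_const lam
      simpa [div_eq_mul_inv, -mul_inv_rev] using (this.inv₀ (by simpa using hlam.ne')).const_mul 2
    obtain ⟨k, hk⟩ := (hlim.eventually_lt_const ha).exists
    have h2 : Tendsto (fun N : ℕ => 2 / ((1 - ε k) * lam) + 2 / Real.log N) atTop
        (𝓝 (2 / ((1 - ε k) * lam))) := by simpa using hlog.const_add _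
    filter_upwards [h2.eventually_lt_const hk, eventually_div_log_le hM hlam (hε1 k) (hup k)]
      with N h3 h4 using h4.trans_lt h3

end Interpolation

/-! ### Matching two independent run processes -/

section RunProcess

/-- The law of a sequence of independent lengths, the `j`-th one with law `γ (f^[j] s)`. -/
noncomputable def runMeasure {A : Type*} (f : A → A) (γ : A → Measure ℕ) (s : A) :
    Measure (ℕ → ℕ) :=
  Measure.infinitePi fun j => γ (f^[j] s)

variable {A : Type*} {f : A → A} {γ : A → Measure ℕ}

/-- The probability that a run-length block, with first symbol `c`, is `w`. -/
noncomputable def blockProb (f : A → A) (γ : A → Measure ℕ) (c : A) {k : ℕ} (w : Fin k → ℕ) :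
    ℝ≥0∞ :=
  ∏ d : Fin k, γ (f^[d] c) {w d}

variable {κ : A → ℝ} {σ : ℝ}

/-- Blocks of even length see both letters equally often, so their collision probability does not
depend on the starting letter. -/
theorem tsum_blockProb_sq (hκ : ∀ s, ∑' k, γ s {k} ^ 2 = ENNReal.ofReal (κ s))
    (hκσ : ∀ s, κ s * κ (f s) = σ ^ 2) (h0 : ∀ s, 0 < κ s) (hσ0 : 0 < σ) (c : A) (r : ℕ) :
    ∑' w : Fin (2 * r) → ℕ, blockProb f γ c w ^ 2 = ENNReal.ofReal (σ ^ r) ^ 2 := by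
  simp_rw [blockProb, ← Finset.prod_pow]
  rw [tsum_pi_prod fun (j : Fin (2 * r)) k => γ (f^[j] c) {k} ^ 2,
    Fin.prod_univ_eq_prod_range fun j => ∑' k, γ (f^[j] c) {k} ^ 2]
  simp_rw [hκ]
  rw [← ENNReal.ofReal_prod_of_nonneg fun j _ => (h0 _).le, prod_iterate_even hκσ,
    ← ENNReal.ofReal_pow (by positivity), ← pow_mul, mul_comm]

variable [∀ s, IsProbabilityMeasure (γ s)]

instance (s : A) : IsProbabilityMeasure (runMeasure f γ s) := by
  unfold runMeasure
  infer_instance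

theorem runMeasure_forall_eq {ι : Type*} [Fintype ι] (s : A) {g : ι → ℕ}
    (hg : Function.Injective g) (w : ι → ℕ) :
    runMeasure f γ s {l | ∀ p, l (g p) = w p} = ∏ p, γ (f^[g p] s) {w p} := by
  have h := congrArg (fun ν => ν {w})
    (Measure.map_infinitePi_infinitePi_of_inj (P := fun j => γ (f^[j] s)) hg)
  simp only [Measure.infinitePi_singleton_of_fintype] at h
  rw [← h, Measure.map_apply (by fun_prop) (measurableSet_singleton w)]
  congr 1
  ext l
  simp [funext_iff]

theorem measurable_window {k : ℕ} (i : ℕ) :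
    Measurable fun (l : ℕ → ℕ) (d : Fin k) => l (i + d) := by
  fun_prop

theorem runMeasure_window_eq (s : A) (i : ℕ) {k : ℕ} (w : Fin k → ℕ) :
    runMeasure f γ s {l | (fun d : Fin k => l (i + d)) = w} = blockProb f γ (f^[i] s) w := by
  have hg : Function.Injective fun d : Fin k => i + (d : ℕ) := fun d d' h => by
    simpa [Fin.ext_iff] using h
  have h := runMeasure_forall_eq (f := f) (γ := γ) s hg w
  simp only [funext_iff]
  rw [h, blockProb]
  refine Finset.prod_congr rfl fun d _ => ?_
  rw [add_comm, Function.iterate_add_apply]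

theorem runMeasure_windows_eq (s : A) {i j k : ℕ} (hij : i + k ≤ j) (w w' : Fin k → ℕ) :
    runMeasure f γ s {l | (fun d : Fin k => l (i + d)) = w ∧ (fun d : Fin k => l (j + d)) = w'}
      = blockProb f γ (f^[i] s) w * blockProb f γ (f^[j] s) w' := by
  have hg : Function.Injective (Sum.elim (fun d : Fin k => i + (d : ℕ)) fun d : Fin k => j + (d : ℕ)) := by
    refine Function.Injective.sumElim ?_ ?_ ?_
    · exact fun d d' h => by simpa [Fin.ext_iff] using h
    · exact fun d d' h => by simpa [Fin.ext_iff] using h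
    · exact fun d d' => by have := d.2; omega
  have h := runMeasure_forall_eq (f := f) (γ := γ) s hg (Sum.elim w w')
  simp only [Sum.forall, Sum.elim_inl, Sum.elim_inr, Fintype.prod_sum_type] at h
  simp only [funext_iff]
  rw [h, blockProb, blockProb]
  congr 1 <;> refine Finset.prod_congr rfl fun d _ => ?_ <;>
    rw [add_comm, Function.iterate_add_apply]

/-- Upper bound for the probability of a long common substring at two given positions. -/
theorem prod_runMeasure_match_le (hκ : ∀ s, ∑' k, γ s {k} ^ 2 = ENNReal.ofReal (κ s))
    (hκσ : ∀ s, κ s * κ (f s) = σ ^ 2) (h0 : ∀ s, 0 < κ s) (hσ0 : 0 < σ) (s s' : A)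
    {r : ℕ} (hr : 0 < r) (i j : ℕ) :
    ((runMeasure f γ s).prod (runMeasure f γ s'))
      {z | ∀ d < 2 * r, runPairs f s z.1 (i + d) = runPairs f s' z.2 (j + d)}
      ≤ ENNReal.ofReal (σ ^ r) ^ 2 := by
  by_cases hc : f^[i] s = f^[j] s'
  · rw [← tsum_blockProb_sq hκ hκσ h0 hσ0 (f^[i] s) r]
    have hsub : {z : (ℕ → ℕ) × (ℕ → ℕ) |
        ∀ d < 2 * r, runPairs f s z.1 (i + d) = runPairs f s' z.2 (j + d)} ⊆
        {z | (fun d : Fin (2 * r) => z.1 (i + d)) = fun d : Fin (2 * r) => z.2 (j + d)} :=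
      fun z hz => funext fun d => (Prod.mk.inj (hz d d.2)).2
    refine (measure_mono hsub).trans ?_
    rw [prod_measure_eq_tsum (measurable_window i) (measurable_window j)]
    simp_rw [runMeasure_window_eq, ← hc, sq]
    exact le_rfl
  -- Out of phase, the symbols already differ at `d = 0`.
  · refine le_of_eq_of_le (measure_mono_null (t := ∅) (fun z hz => hc ?_) measure_empty) zero_le
    exact (Prod.mk.inj (hz 0 (by omega))).1

theorem prod_runMeasure_le_lcsLength_le (hκ : ∀ s, ∑' k, γ s {k} ^ 2 = ENNReal.ofReal (κ s))
    (hκσ : ∀ s, κ s * κ (f s) = σ ^ 2) (h0 : ∀ s, 0 < κ s) (hσ0 : 0 < σ) (s s' : A)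
    {r : ℕ} (hr : 0 < r) (n : ℕ) :
    ((runMeasure f γ s).prod (runMeasure f γ s'))
      {z | 2 * r ≤ lcsLength n (runPairs f s z.1) (runPairs f s' z.2)}
      ≤ ENNReal.ofReal ((n * σ ^ r) ^ 2) := by
  have hsub : {z : (ℕ → ℕ) × (ℕ → ℕ) |
      2 * r ≤ lcsLength n (runPairs f s z.1) (runPairs f s' z.2)} ⊆
      ⋃ p ∈ Finset.range n ×ˢ Finset.range n, {z |
        ∀ d < 2 * r, runPairs f s z.1 (p.1 + d) = runPairs f s' z.2 (p.2 + d)} := by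
    intro z hz
    obtain ⟨i, j, hi, hj, h⟩ := le_lcsLength_iff.mp hz
    exact Set.mem_biUnion (x := (i, j)) (by
      simp only [Finset.coe_product, Set.mem_prod, Finset.coe_range, Set.mem_Iio]
      omega) h
  refine (measure_mono hsub).trans ((measure_biUnion_finset_le _ _).trans ?_)
  refine (Finset.sum_le_sum fun p _ =>
    prod_runMeasure_match_le hκ hκσ h0 hσ0 s s' hr p.1 p.2).trans (le_of_eq ?_)
  rw [Finset.sum_const, Finset.card_product, Finset.card_range, nsmul_eq_mul,
    mul_pow, ENNReal.ofReal_mul (by positivity), ENNReal.ofReal_pow n.cast_nonneg,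
    ENNReal.ofReal_pow (pow_nonneg hσ0.le r), ENNReal.ofReal_natCast]
  push_cast
  ring

/-- Even block length makes all blocks of one sequence start with the same letter. Shifting one
sequence by one run, if needed, aligns the phases of the two; this is the `+ 1` in the length. The
disjoint blocks then satisfy the second moment bound with `t = σ ^ r`. -/
theorem prod_runMeasure_lcsLength_lt_le (hf : ∀ s t, t ≠ s ↔ t = f s)
    (hκ : ∀ s, ∑' k, γ s {k} ^ 2 = ENNReal.ofReal (κ s))
    (hκσ : ∀ s, κ s * κ (f s) = σ ^ 2) (h0 : ∀ s, 0 < κ s) (hσ0 : 0 < σ) (s s' : A)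
    {r m : ℕ} (hm : 0 < m) :
    ((runMeasure f γ s).prod (runMeasure f γ s'))
      {z | lcsLength (2 * r * m + 1) (runPairs f s z.1) (runPairs f s' z.2) < 2 * r}
      ≤ ENNReal.ofReal (3 / (m * σ ^ r)) := by
  have hff : ∀ s, f (f s) = s := fun s => ((hf (f s) s).mp ((hf s (f s)).mpr rfl).symm).symm
  obtain ⟨o, o', ho, ho', c, hc, hc'⟩ :
      ∃ o o', o ≤ 1 ∧ o' ≤ 1 ∧ ∃ c, f^[o] s = c ∧ f^[o'] s' = c := by
    by_cases hss : s' = s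
    · exact ⟨0, 0, by omega, by omega, s, rfl, hss⟩
    · exact ⟨1, 0, by omega, by omega, f s, rfl, (hf s s').mp hss⟩
  have heven : ∀ (i : ℕ) (c : A), f^[2 * r * i] c = c := fun i c => by
    rw [mul_assoc, Function.iterate_mul]
    have : f^[2] = id := funext hff
    rw [this, Function.iterate_id, id]
  have hphase : ∀ (o i : ℕ) (s : A), f^[o + 2 * r * i] s = f^[o] s := fun o i s => by
    rw [Function.iterate_add_apply, heven]
  have hpair : ∀ (s : A) (o : ℕ) (i j : Fin m), i ≠ j → ∀ w w' : Fin (2 * r) → ℕ,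
      runMeasure f γ s {l | (fun d : Fin (2 * r) => l (o + 2 * r * i + d)) = w ∧
        (fun d : Fin (2 * r) => l (o + 2 * r * j + d)) = w'}
        = blockProb f γ (f^[o] s) w * blockProb f γ (f^[o] s) w' := by
    intro s o i j hij w w'
    rcases lt_or_gt_of_ne (Fin.val_ne_of_ne hij) with hlt | hlt
    · have : 2 * r * (i + 1) ≤ 2 * r * j := Nat.mul_le_mul_left _ hlt
      rw [runMeasure_windows_eq s (by linarith), hphase, hphase]
    · have : 2 * r * (j + 1) ≤ 2 * r * i := Nat.mul_le_mul_left _ hlt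
      simp_rw [and_comm (b := _ = w')]
      rw [runMeasure_windows_eq s (by linarith), hphase, hphase, mul_comm]
  have key := measureReal_forall_ne_le (μ := runMeasure f γ s) (ν := runMeasure f γ s') hm
    (X := fun i l (d : Fin (2 * r)) => l (o + 2 * r * i + d))
    (Y := fun i l (d : Fin (2 * r)) => l (o' + 2 * r * i + d))
    (fun i => measurable_window _) (fun i => measurable_window _) (t := σ ^ r) (by positivity)
    (tsum_blockProb_sq hκ hκσ h0 hσ0 c r)
    (fun i w => by rw [runMeasure_window_eq, hphase, hc])
    (fun i w => by rw [runMeasure_window_eq, hphase, hc'])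
    (fun i j hij w w' => by rw [hpair s o i j hij, hc])
    (fun i j hij w w' => by rw [hpair s' o' i j hij, hc'])
  rw [measureReal_def] at key
  refine (measure_mono ?_).trans
    ((ENNReal.le_ofReal_iff_toReal_le (measure_ne_top _ _) (by positivity)).mpr key)
  intro z hz i j hne
  refine absurd hz (not_lt.mpr (le_lcsLength_iff.mpr
    ⟨o + 2 * r * i, o' + 2 * r * j, ?_, ?_, fun d hd => Prod.ext ?_ (congrFun hne ⟨d, hd⟩)⟩))
  · have : 2 * r * (i + 1) ≤ 2 * r * m := Nat.mul_le_mul_left _ i.2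
    linarith
  · have : 2 * r * (j + 1) ≤ 2 * r * m := Nat.mul_le_mul_left _ j.2
    linarith
  · change f^[_] s = f^[_] s'
    rw [add_comm _ d, add_comm _ d, Function.iterate_add_apply, Function.iterate_add_apply f d,
      hphase, hphase, hc, hc']

theorem tsum_ofReal_mul_exp_ne_top {C c : ℝ} (hc : 0 < c) {v : ℕ → ℝ≥0∞}
    (h : ∀ r, v r ≤ ENNReal.ofReal (C * Real.exp (-c * r))) : ∑' r, v r ≠ ∞ := by
  refine ne_top_of_le_ne_top ?_ (ENNReal.tsum_le_tsum h)
  refine Summable.tsum_ofReal_ne_top (Summable.mul_left C ?_)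
  simpa [mul_comm] using Real.summable_exp_nat_mul_iff.mpr (neg_lt_zero.mpr hc)

/-- Borel-Cantelli along `r`, for each `ε k`: the failure probabilities are at most `3 * exp (-ε *
lam * r)` below and `exp (-2 * ε * lam * r)` above. -/
theorem ae_tendsto_lcsLength_runPairs (hf : ∀ s t, t ≠ s ↔ t = f s)
    (hκ : ∀ s, ∑' k, γ s {k} ^ 2 = ENNReal.ofReal (κ s))
    (hκσ : ∀ s, κ s * κ (f s) = σ ^ 2) (h0 : ∀ s, 0 < κ s) (hσ0 : 0 < σ) (hσ1 : σ < 1)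
    (s s' : A) :
    ∀ᵐ z ∂(runMeasure f γ s).prod (runMeasure f γ s'),
      Tendsto (fun n : ℕ =>
        (lcsLength n (runPairs f s z.1) (runPairs f s' z.2) : ℝ) / Real.log n) atTop
        (𝓝 (2 / -Real.log σ)) := by
  have hlam : 0 < -Real.log σ := neg_pos.mpr (Real.log_neg hσ0 hσ1)
  have hσ : ∀ r : ℕ, σ ^ r = Real.exp (-(-Real.log σ) * r) := fun r => by
    rw [neg_neg, mul_comm, Real.exp_nat_mul, Real.exp_log hσ0]
  set lam := -Real.log σ
  let ε : ℕ → ℝ := fun k => 1 / ((k : ℝ) + 1 + 1)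
  have hε0 : ∀ k, 0 < ε k := fun k => by positivity
  have hε1 : ∀ k, ε k < 1 := fun k => by
    rw [div_lt_one (by positivity)]
    have : (0 : ℝ) ≤ k := k.cast_nonneg
    linarith
  have hε : Tendsto ε atTop (𝓝 0) := by
    have := (tendsto_add_atTop_iff_nat 1).mpr (tendsto_one_div_add_atTop_nhds_zero_nat (𝕜 := ℝ))
    simpa [ε] using this
  have hlow : ∀ᵐ z ∂(runMeasure f γ s).prod (runMeasure f γ s'), ∀ k, ∀ᶠ r : ℕ in atTop,
      2 * r ≤ lcsLength (2 * r * ⌈Real.exp ((1 + ε k) * lam * r)⌉₊ + 1)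
        (runPairs f s z.1) (runPairs f s' z.2) := by
    refine ae_all_iff.mpr fun k => ?_
    refine (ae_eventually_notMem (s := fun r : ℕ => {z : (ℕ → ℕ) × (ℕ → ℕ) |
      lcsLength (2 * r * ⌈Real.exp ((1 + ε k) * lam * r)⌉₊ + 1)
        (runPairs f s z.1) (runPairs f s' z.2) < 2 * r}) ?_).mono
      fun z hz => hz.mono fun r hr => not_lt.mp hr
    refine tsum_ofReal_mul_exp_ne_top (C := 3) (c := ε k * lam) (mul_pos (hε0 k) hlam) fun r => ?_
    refine (prod_runMeasure_lcsLength_lt_le hf hκ hκσ h0 hσ0 s s'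
      (Nat.ceil_pos.mpr (Real.exp_pos _))).trans (ENNReal.ofReal_le_ofReal ?_)
    rw [hσ, neg_mul (ε k * lam), Real.exp_neg (ε k * lam * r), ← div_eq_mul_inv]
    refine div_le_div_of_nonneg_left (by norm_num) (Real.exp_pos _) ?_
    calc Real.exp (ε k * lam * r) = Real.exp ((1 + ε k) * lam * r) * Real.exp (-lam * r) := by
          rw [← Real.exp_add]
          ring_nf
      _ ≤ _ := mul_le_mul_of_nonneg_right (Nat.le_ceil _) (Real.exp_pos _).le
  have hup : ∀ᵐ z ∂(runMeasure f γ s).prod (runMeasure f γ s'), ∀ k, ∀ᶠ r : ℕ in atTop,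
      lcsLength ⌊Real.exp ((1 - ε k) * lam * r)⌋₊
        (runPairs f s z.1) (runPairs f s' z.2) < 2 * r := by
    refine ae_all_iff.mpr fun k => ?_
    -- The index is shifted to `r + 1` because the union bound needs a nonempty block.
    have := ae_eventually_notMem (μ := (runMeasure f γ s).prod (runMeasure f γ s'))
      (s := fun r : ℕ => {z : (ℕ → ℕ) × (ℕ → ℕ) | 2 * (r + 1) ≤
        lcsLength ⌊Real.exp ((1 - ε k) * lam * (r + 1 : ℕ))⌋₊
        (runPairs f s z.1) (runPairs f s' z.2)}) ?_
    · refine this.mono fun z hz => ?_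
      rw [← map_add_atTop_eq_nat 1, eventually_map]
      exact hz.mono fun r hr => not_le.mp hr
    refine tsum_ofReal_mul_exp_ne_top (C := 1) (c := 2 * (ε k * lam))
      (mul_pos two_pos (mul_pos (hε0 k) hlam)) fun r => ?_
    refine (prod_runMeasure_le_lcsLength_le hκ hκσ h0 hσ0 s s' (Nat.succ_pos r) _).trans
      (ENNReal.ofReal_le_ofReal ?_)
    rw [hσ]
    calc _ ≤ (Real.exp ((1 - ε k) * lam * (r + 1 : ℕ)) * Real.exp (-lam * (r + 1 : ℕ))) ^ 2 := by
          gcongr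
          exact Nat.floor_le (Real.exp_pos _).le
      _ = Real.exp (2 * -(ε k * lam * (r + 1 : ℕ))) := by
          rw [← Real.exp_add, ← Real.exp_nat_mul]
          push_cast
          ring_nf
      _ ≤ _ := by
          rw [one_mul, Real.exp_le_exp]
          push_cast
          have := mul_pos (hε0 k) hlam
          nlinarith
  filter_upwards [hlow, hup] with z h1 h2
  exact tendsto_div_log_of_exp_bounds (monotone_lcsLength _ _) hlam hε0 hε1 hε h1 h2

end RunProcess

/-! ### Back to the Markov chain -/

section Transfer

variable {A : Type*} [Fintype A] [DecidableEq A] [MeasurableSpace A] [MeasurableSingletonClass A]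
  {P : Matrix A A ℝ} {μ : Measure (ℕ → A)} {f : A → A} {γ : A → Measure ℕ}

theorem ae_tendsto_lcsLengthRLE (hμ : IsStationaryMarkovChain P μ) (hf : ∀ s t, t ≠ s ↔ t = f s)
    (hP : ∀ s, P s s < 1) [∀ s, IsProbabilityMeasure (γ s)] (hγ0 : ∀ s, γ s {0} = 0)
    (hγ : ∀ s m, γ s {m + 1} = ENNReal.ofReal (P s s) ^ m * ENNReal.ofReal (P s (f s)))
    {κ : A → ℝ} {σ : ℝ} (hκ : ∀ s, ∑' k, γ s {k} ^ 2 = ENNReal.ofReal (κ s))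
    (hκσ : ∀ s, κ s * κ (f s) = σ ^ 2) (h0 : ∀ s, 0 < κ s) (hσ0 : 0 < σ) (hσ1 : σ < 1) :
    ∀ᵐ z ∂(μ.prod μ), Tendsto (fun n : ℕ => (lcsLengthRLE n z.1 z.2 : ℝ) / Real.log n) atTop
      (𝓝 (2 / -Real.log σ)) := by
  have := hμ.isProbabilityMeasure
  have hE : ∀ s, MeasurableSet {x : ℕ → A | x 0 = s} := fun s =>
    measurableSet_eq_fun (measurable_pi_apply 0) measurable_const
  have key : ∀ s s' : A, ∀ᵐ z ∂(μ.prod μ), z ∈ {x : ℕ → A | x 0 = s} ×ˢ {x : ℕ → A | x 0 = s'} →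
      Tendsto (fun n : ℕ => (lcsLength n (runPairs f s (runLengths z.1))
        (runPairs f s' (runLengths z.2)) : ℝ) / Real.log n) atTop (𝓝 (2 / -Real.log σ)) := by
    intro s s'
    -- For fixed first symbols, the restricted product measure maps to a multiple of a product of
    -- run measures.
    rw [← ae_restrict_iff' ((hE s).prod (hE s')), ← Measure.prod_restrict]
    refine ae_of_ae_map (f := Prod.map runLengths runLengths)
      (p := fun l : (ℕ → ℕ) × (ℕ → ℕ) => Tendsto (fun n : ℕ => (lcsLength n (runPairs f s l.1)
        (runPairs f s' l.2) : ℝ) / Real.log n) atTop (𝓝 (2 / -Real.log σ)))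
      (measurable_runLengths.prodMap measurable_runLengths).aemeasurable ?_
    rw [← Measure.map_prod_map _ _ measurable_runLengths measurable_runLengths,
      map_runLengths hμ hf hP hγ0 hγ s, map_runLengths hμ hf hP hγ0 hγ s',
      Measure.prod_smul_left, Measure.prod_smul_right]
    exact Measure.ae_smul_measure (Measure.ae_smul_measure
      (ae_tendsto_lcsLength_runPairs hf hκ hκσ h0 hσ0 hσ1 s s') _) _
  have hall := ae_all_iff.mpr fun s => ae_all_iff.mpr fun s' => key s s'
  have henc := ae_encode_eq_runPairs hμ hf hP hγ0 hγ
  filter_upwards [hall, Measure.quasiMeasurePreserving_fst.ae henc,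
    Measure.quasiMeasurePreserving_snd.ae henc] with z h h1 h2
  simp only [lcsLengthRLE, h1, h2]
  exact h _ _ ⟨rfl, rfl⟩

end Transfer

/-! ### Geometric run lengths and their collision probability -/

section Geometric

/-- The law of the length of a run which ends after each symbol with probability `t`. -/
noncomputable def runLaw (t : unitInterval) : Measure ℕ := (geometricMeasure t).map Nat.succ

instance (t : unitInterval) : IsProbabilityMeasure (runLaw t) :=
  Measure.isProbabilityMeasure_map (Measurable.of_discrete).aemeasurable

theorem runLaw_singleton_zero (t : unitInterval) : runLaw t {0} = 0 := by
  have h : Nat.succ ⁻¹' {0} = ∅ := by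
    ext n
    simp
  rw [runLaw, Measure.map_apply Measurable.of_discrete (measurableSet_singleton 0), h,
    measure_empty]

theorem runLaw_singleton_succ {t : unitInterval} (ht : t ≠ 0) (m : ℕ) :
    runLaw t {m + 1} = ENNReal.ofReal (1 - t) ^ m * ENNReal.ofReal t := by
  have h : Nat.succ ⁻¹' {m + 1} = {m} := by
    ext n
    simp
  rw [runLaw, Measure.map_apply Measurable.of_discrete (measurableSet_singleton _), h,
    geometricMeasure_singleton ht, ENNReal.ofReal_mul (pow_nonneg (sub_nonneg.mpr t.2.2) _),
    ENNReal.ofReal_pow (sub_nonneg.mpr t.2.2)]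

/-- A geometric series of ratio `(1 - t) ^ 2`: its value `t ^ 2 / (1 - (1 - t) ^ 2)` simplifies. -/
theorem tsum_runLaw_sq {t : unitInterval} (ht : t ≠ 0) :
    ∑' k, runLaw t {k} ^ 2 = ENNReal.ofReal (t / (2 - t)) := by
  have h0 : (0 : ℝ) < t := lt_of_le_of_ne t.2.1 fun h => ht (Subtype.ext h.symm)
  have h1 : (0 : ℝ) ≤ 1 - t := sub_nonneg.mpr t.2.2
  have h2 : (0 : ℝ) < 1 - (1 - t) ^ 2 := by nlinarith [t.2.2]
  rw [tsum_eq_zero_add' ENNReal.summable, runLaw_singleton_zero]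
  simp_rw [runLaw_singleton_succ ht, mul_pow, ← pow_mul, mul_comm _ 2, pow_mul]
  rw [ENNReal.tsum_mul_right, ENNReal.tsum_geometric, ← ENNReal.ofReal_pow h1,
    ← ENNReal.ofReal_one, ← ENNReal.ofReal_sub _ (by positivity), ← ENNReal.ofReal_inv_of_pos h2,
    ← ENNReal.ofReal_pow h0.le, ← ENNReal.ofReal_mul (by positivity), zero_pow two_ne_zero,
    zero_add]
  congr 1
  have h3 : (0 : ℝ) < 2 - t := by linarith [t.2.2]
  field_simp
  ring

end Geometric

end RunLength

/-! ### The theorem, with explicit constants -/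

theorem mainTheorem4 {A : Type*} [Fintype A] [DecidableEq A] [MeasurableSpace A]
    [MeasurableSingletonClass A] (a b : A) (hab : a ≠ b) (hA : ∀ s : A, s = a ∨ s = b)
    (p q : ℝ) (hp0 : 0 < p) (hp1 : p < 1) (hq0 : 0 < q) (hq1 : q < 1)
    (P : Matrix A A ℝ) (hPa : P a a = p) (hPb : P b b = q)
    (μ : Measure (ℕ → A)) (hμ : RunLength.IsStationaryMarkovChain P μ) :
    RunLength.HasRenyiEntropy 2 (μ.map RunLength.encode)
        (-(1 / 2) * Real.log (((1 - p) * (1 - q)) / ((1 + p) * (1 + q)))) ∧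
      ∀ᵐ z ∂(μ.prod μ),
        Tendsto (fun n : ℕ => (RunLength.lcsLengthRLE n z.1 z.2 : ℝ) / Real.log n) atTop
          (𝓝 (4 / Real.log (((1 + p) * (1 + q)) / ((1 - p) * (1 - q))))) := by
  let f : A → A := fun s => if s = a then b else a
  have hfa : f a = b := if_pos rfl
  have hfb : f b = a := if_neg hab.symm
  have hf : ∀ s t, t ≠ s ↔ t = f s := by
    intro s t
    rcases hA s with rfl | rfl <;> rcases hA t with rfl | rfl <;>
      simp [hfa, hfb, hab, hab.symm]
  have hP0 : ∀ s, 0 < P s s := fun s => by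
    rcases hA s with rfl | rfl
    · rwa [hPa]
    · rwa [hPb]
  have hP1 : ∀ s, P s s < 1 := fun s => by
    rcases hA s with rfl | rfl
    · rwa [hPa]
    · rwa [hPb]
  have hPf : ∀ s, P s (f s) = 1 - P s s := by
    intro s
    have h := Matrix.sum_row_of_mem_rowStochastic hμ.stochastic s
    rw [Fintype.sum_eq_add s (f s) ((hf s (f s)).mpr rfl).symm
      fun x hx => absurd ((hf s x).mp hx.1) hx.2] at h
    linarith
  let θ : A → unitInterval := fun s => ⟨1 - P s s, by linarith [hP1 s], by linarith [hP0 s]⟩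
  have hθ : ∀ s, θ s ≠ 0 := fun s h => by
    have : 1 - P s s = 0 := congrArg Subtype.val h
    linarith [hP1 s]
  let κ : A → ℝ := fun s => (1 - P s s) / (1 + P s s)
  have hκ0 : ∀ s, 0 < κ s := fun s =>
    div_pos (by linarith [hP1 s]) (by linarith [hP0 s])
  have hκ1 : ∀ s, κ s < 1 := fun s => by
    rw [div_lt_one (by linarith [hP0 s])]
    linarith [hP0 s]
  have hprod : 0 < κ a * κ b := mul_pos (hκ0 a) (hκ0 b)
  have hκ : ∀ s, ∑' k, RunLength.runLaw (θ s) {k} ^ 2 = ENNReal.ofReal (κ s) := fun s => by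
    rw [RunLength.tsum_runLaw_sq (hθ s)]
    congr 2
    change 2 - (1 - P s s) = _
    ring
  -- The rate per run is the geometric mean of the two collision probabilities, which is the source
  -- of the factor `1 / 2` in the entropy.
  have hκσ : ∀ s, κ s * κ (f s) = √(κ a * κ b) ^ 2 := fun s => by
    rw [Real.sq_sqrt hprod.le]
    rcases hA s with rfl | rfl
    · rw [hfa]
    · rw [hfb, mul_comm]
  have hσ0 : 0 < √(κ a * κ b) := Real.sqrt_pos.mpr hprod
  have hσ1 : √(κ a * κ b) < 1 := by
    rw [Real.sqrt_lt' one_pos]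
    nlinarith [hκ0 a, hκ0 b, hκ1 a, hκ1 b]
  have hγ : ∀ s m, RunLength.runLaw (θ s) {m + 1}
      = ENNReal.ofReal (P s s) ^ m * ENNReal.ofReal (P s (f s)) := fun s m => by
    rw [RunLength.runLaw_singleton_succ (hθ s), hPf]
    congr 3
    exact sub_sub_cancel 1 _
  have hγ0 : ∀ s, RunLength.runLaw (θ s) {0} = 0 := fun s => RunLength.runLaw_singleton_zero _
  have hab' : κ a * κ b = ((1 - p) * (1 - q)) / ((1 + p) * (1 + q)) := by
    rw [← hPa, ← hPb, mul_div_mul_comm]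
  have hlog : Real.log √(κ a * κ b)
      = 1 / 2 * Real.log (((1 - p) * (1 - q)) / ((1 + p) * (1 + q))) := by
    rw [Real.log_sqrt hprod.le, hab']
    ring
  constructor
  · have h := RunLength.hasRenyiEntropy_map_encode hμ hf hP1 hγ0 hγ hκ hκσ hκ0
      (fun s => (hκ1 s).le) hσ0 hσ1.le
    rwa [hlog, ← neg_mul] at h
  · have h := RunLength.ae_tendsto_lcsLengthRLE hμ hf hP1 hγ0 hγ hκ hκσ hκ0 hσ0 hσ1
    have hlim : 2 / -Real.log √(κ a * κ b)
        = 4 / Real.log (((1 + p) * (1 + q)) / ((1 - p) * (1 - q))) := by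
      rw [hlog, ← inv_div ((1 + p) * (1 + q)), Real.log_inv]
      ring
    rwa [hlim] at h
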